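/- For a finite poset $P$, let $c_i(P)$ be the number of $i$-element chains of $P$ (the empty chain included), let $N$ be the largest cardinality of a chain of $P$, and let $$h_P(x)=\sum_{i=0}^{N} c_i(P)\,x^i(1-x)^{N-i}$$ be the $h$-polynomial of the order complex of $P$ (the simplicial complex of all chains of $P$). Let $C_2$ be the two-element chain. For a finite poset $L$ with minimum $\hat 0$ and maximum $\hat 1$, put $\mathrm{Pyr}(L)=L\times C_2$, and let $\mathrm{Prism}(L)$ be the poset obtained by adding a minimum element to $(L\setminus\{\hat 0\})\times\big((C_2\times C_2)\setminus\{\hat 0\}\big)$. The poset $P$ is Cohen–Macaulay if its order complex $\Delta$ is so over $\mathbb{Q}$, that is, $\widetilde H_i(\mathrm{link}_\Delta(F);\mathbb{Q})=0$ for every face $F\in\Delta$ (the empty one included) and every $i<\dim \mathrm{link}_\Delta(F)$. A real polynomial is real-rooted if it is zero or all its complex roots are real. A nonzero real-rooted polynomial $f$ with roots $\alpha_1\ge\alpha_2\ge\cdots$ (listed with multiplicity) interlaces a nonzero real-rooted polynomial $g$ with roots $\beta_1\ge\beta_2\ge\cdots$ if $\cdots\le\alpha_2\le\beta_2\le\alpha_1\le\beta_1$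 (so that $\deg g-\deg f\in\{0,1\}$); one also says that $g$ is interlaced by $f$. By convention, the zero polynomial interlaces and is interlaced by every real-rooted polynomial. **Theorem.** Let $L$ be a finite poset with $\hat 0$ and $\hat 1$ which is graded of positive rank $n$ (all maximal chains of $L$ have $n+1$ elements). (a) We have $$h_{\mathrm{Pyr}(L)}(x)=(1+nx)\,h_L(x)+(x-x^2)\,h_L'(x),$$ $$h_{\mathrm{Prism}(L)}(x)=(1+(2n-1)x)\,h_L(x)+2(x-x^2)\,h_L'(x)=2\,h_{\mathrm{Pyr}(L)}(x)-(1+x)\,h_L(x).$$ (b) Assume that $L$ is Cohen–Macaulay. If $h_L(x)$ is real-rooted, then $h_{\mathrm{Pyr}(L)}(x)$ and $h_{\mathrm{Prism}(L)}(x)$ are also real-rooted, and each of them is interlaced by $h_L(x)$. -/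

import Mathlib

open Polynomial

namespace ChainPoly

/-- The order complex of a poset: the family of all its finite chains (the empty one included). -/
def orderComplex (P : Type*) [PartialOrder P] : Set (Finset P) :=
  {s | IsChain (· ≤ ·) (s : Set P)}

/-- The number `c_k(P)` of `k`-element chains of the (finite) poset `P`. -/
noncomputable def chainCount (P : Type*) [PartialOrder P] (k : ℕ) : ℕ :=
  Set.ncard {s : Finset P | s ∈ orderComplex P ∧ s.card = k}

/-- The largest cardinality of a chain of the (finite) poset `P`. -/
noncomputable def maxChainCard (P : Type*) [PartialOrder P] : ℕ :=
  sSup {k : ℕ | ∃ s ∈ orderComplex P, s.card = k}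

/-- The `h`-polynomial of the order complex of the finite poset `P`:
`∑ i ≤ N, c_i(P) x ^ i (1 - x) ^ (N - i)`, where `N` is the largest cardinality of a chain. -/
noncomputable def hPoly (P : Type*) [PartialOrder P] : ℝ[X] :=
  ∑ i ∈ Finset.range (maxChainCard P + 1),
    C (chainCount P i : ℝ) * X ^ i * (1 - X) ^ (maxChainCard P - i)

/-- The poset `L`, having minimum `⊥` and maximum `⊤`, is graded of rank `n`:
there is a rank function `ρ` which starts at `0`, ends at `n` and increases by exactly one
along every covering relation. -/
def IsGradedOfRank (L : Type*) [PartialOrder L] [BoundedOrder L] (n : ℕ) : Prop :=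
  ∃ ρ : L → ℕ, ρ ⊥ = 0 ∧ ρ ⊤ = n ∧ ∀ a b : L, a ⋖ b → ρ b = ρ a + 1

/-- The pyramid over `L`: the product of `L` with the two-element chain. -/
abbrev Pyr (L : Type*) : Type _ := L × Fin 2

/-- The prism over `L`: a minimum element is added to
`(L ∖ {⊥}) × ((C × C) ∖ {⊥})`, where `C` is the two-element chain. -/
abbrev Prism (L : Type*) [PartialOrder L] [OrderBot L] : Type _ :=
  WithBot ({x : L // x ≠ ⊥} × {y : Fin 2 × Fin 2 // y ≠ ⊥})

open Classical in
/-- The simplicial boundary operator with rational coefficients, on finite chains of a poset.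
A chain `x₀ < ⋯ < x_k` is sent to the alternating sum of its faces, the face that omits `x_j`
having sign `(-1) ^ j`; here `j` is the number of elements of the chain below `x_j`.
The boundary of a one-element chain is the empty chain (so that reduced homology is computed). -/
noncomputable def boundary (P : Type*) [PartialOrder P] :
    (Finset P →₀ ℚ) →ₗ[ℚ] (Finset P →₀ ℚ) :=
  Finsupp.linearCombination ℚ fun s : Finset P =>
    ∑ x ∈ s, Finsupp.single (s.erase x) ((-1 : ℚ) ^ (s.filter (· < x)).card)

/-- For a subcomplex `K` of the order complex of `P`, the space of rational simplicial chains
spanned by the faces of `K` with `k` elements, that is, of dimension `k - 1`. -/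
def simplicialChains {P : Type*} (K : Set (Finset P)) (k : ℕ) : Submodule ℚ (Finset P →₀ ℚ) :=
  Finsupp.supported ℚ ℚ {s | s ∈ K ∧ s.card = k}

/-- The reduced homology over `ℚ` of the subcomplex `K` of the order complex of `P` vanishes in
dimension `k - 1`: every cycle of that dimension is a boundary. -/
def ReducedHomologyVanishes {P : Type*} [PartialOrder P] (K : Set (Finset P)) (k : ℕ) : Prop :=
  ∀ z ∈ simplicialChains K k, boundary P z = 0 →
    ∃ w ∈ simplicialChains K (k + 1), boundary P w = z

open Classical in
/-- The link of the face `F` in the simplicial complex `K`. -/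
def link {P : Type*} (K : Set (Finset P)) (F : Finset P) : Set (Finset P) :=
  {G | Disjoint F G ∧ F ∪ G ∈ K}

/-- A poset is Cohen-Macaulay (over `ℚ`) if its order complex is: for every face `F`, the reduced
homology of the link of `F` vanishes in every dimension `i < dim (link F)`. We write `i = k - 1`, so
that `i < dim (link F)` says that the link has a face with more than `k` elements. -/
def IsCohenMacaulay (P : Type*) [PartialOrder P] : Prop :=
  ∀ F ∈ orderComplex P, ∀ k : ℕ,
    (∃ G ∈ link (orderComplex P) F, k < G.card) →
      ReducedHomologyVanishes (link (orderComplex P) F) k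

/-- A real polynomial is real-rooted if it is zero or all its complex roots are real. -/
def IsRealRooted (f : ℝ[X]) : Prop :=
  f = 0 ∨ ∀ z : ℂ, aeval z f = 0 → z.im = 0

/-- The roots of a real polynomial, with multiplicity, in weakly decreasing order. -/
noncomputable def sortedRoots (f : ℝ[X]) : List ℝ := f.roots.sort (· ≥ ·)

/-- `f` interlaces `g` (equivalently, `g` is interlaced by `f`): both are real-rooted, and one of
them is zero or the roots `α₁ ≥ α₂ ≥ ⋯` of `f` and `β₁ ≥ β₂ ≥ ⋯` of `g` satisfy
`⋯ ≤ α₂ ≤ β₂ ≤ α₁ ≤ β₁`; in particular `g` has as many roots as `f` or one more. -/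
def Interlaces (f g : ℝ[X]) : Prop :=
  IsRealRooted f ∧ IsRealRooted g ∧
    (f = 0 ∨ g = 0 ∨
      (((sortedRoots g).length = (sortedRoots f).length ∨
          (sortedRoots g).length = (sortedRoots f).length + 1) ∧
        (∀ (i : ℕ) (hf : i < (sortedRoots f).length) (hg : i < (sortedRoots g).length),
          (sortedRoots f)[i] ≤ (sortedRoots g)[i]) ∧
        (∀ (i : ℕ) (hf : i < (sortedRoots f).length) (hg : i + 1 < (sortedRoots g).length),
          (sortedRoots g)[i + 1] ≤ (sortedRoots f)[i])))

end ChainPoly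

namespace ChainPoly

/-! Part (a) is a count of chains. A chain of `P × C₂` is a chain of `P` with a place where it
changes level, and at most one element lies on both levels. Hence c_{k+1}(P × C₂) = (k+2) c_{k+1}(P)
+ k c_k(P) (`chainCount_prod_fin_two_succ`). This becomes a differential formula
(`hPoly_prod_fin_two`), since (x - x²) d/dx multiplies x^i (1-x)^(N-i) by i - Nx. For the prism, the
added minimum is a cone point and does not affect h (`hPoly_of_cone`). What remains is (L ∖ {⊥}) ×
V, where V is a union of two 2-element chains with common maximum, and inclusion–exclusion applies
(`chainCount_prod_vee`).

For (b), both polynomials have the form (1 + (e-1)x) h + b (x - x²) h', with (b, e) = (1, n+1) and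
(2, 2n). Up to the factors h^(b-1) and (1-x)^(e+1), this is the derivative of φ = x h^b / (1-x)^e
(`hasDerivAt_rolleFun`). Cohen–Macaulayness makes h positive on [0, ∞) (`eval_hPoly_pos`), so that
its roots are negative, and deg h < n makes φ tend to 0 at -∞. Rolle's theorem gives a critical
point between any two consecutive zeros of φ, which are 0 and the roots of h, and decay gives one
more to their left. A root of h loses at most one in multiplicity. The deg h + 1 roots found in this
way exhaust the degree, and the same count on each side of a threshold t gives interlacing. -/

open Classical in
/-- The `k`-element chains of a finite poset, as a finset. -/
noncomputable def chainsOfCard (P : Type*) [PartialOrder P] [Fintype P] (k : ℕ) :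
    Finset (Finset P) :=
  Finset.univ.filter fun s => IsChain (· ≤ ·) (s : Set P) ∧ s.card = k

/-! ### Chain counts, and invariance of h under removal of a cone point. -/

section Counting

variable {P Q : Type*} [PartialOrder P] [PartialOrder Q]

lemma mem_chainsOfCard [Fintype P] {k : ℕ} {s : Finset P} :
    s ∈ chainsOfCard P k ↔ IsChain (· ≤ ·) (s : Set P) ∧ s.card = k := by
  simp [chainsOfCard]

lemma chainCount_eq_card [Fintype P] (k : ℕ) : chainCount P k = (chainsOfCard P k).card := by
  rw [chainCount, ← Set.ncard_coe_finset]
  congr 1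
  ext s
  simp [chainsOfCard, orderComplex]

lemma isChain_coe_iff {s : Finset P} :
    IsChain (· ≤ ·) (s : Set P) ↔ ∀ x ∈ s, ∀ y ∈ s, x ≤ y ∨ y ≤ x := by
  refine ⟨fun h x hx y hy => h.total hx hy, fun h x hx y hy _ => h x hx y hy⟩

open Classical in
/-- An order embedding identifies the chains of its source with the chains inside its range. -/
lemma chainCount_eq_of_embedding [Fintype P] [Finite Q] (e : Q ↪o P) (k : ℕ) :
    chainCount Q k = ((chainsOfCard P k).filter fun s => ∀ x ∈ s, x ∈ Set.range e).card := by
  cases nonempty_fintype Q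
  rw [chainCount_eq_card]
  refine Finset.card_bij (fun s _ => s.map e.toEmbedding) ?_ ?_ ?_
  · intro s hs
    simp only [mem_chainsOfCard, Finset.mem_filter, isChain_coe_iff] at hs ⊢
    refine ⟨⟨?_, by simpa using hs.2⟩, ?_⟩
    · simpa using hs.1
    · simp
  · intro s _ t _ h
    exact Finset.map_injective _ h
  · intro t ht
    simp only [mem_chainsOfCard, Finset.mem_filter, isChain_coe_iff] at ht
    have hmap : (Finset.univ.filter fun x => e x ∈ t).map e.toEmbedding = t := by
      ext y
      simp only [Finset.mem_map, Finset.mem_filter, Finset.mem_univ, true_and,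
        RelEmbedding.coe_toEmbedding]
      constructor
      · rintro ⟨x, hx, rfl⟩
        exact hx
      · intro hy
        obtain ⟨x, rfl⟩ := ht.2 y hy
        exact ⟨x, hy, rfl⟩
    refine ⟨Finset.univ.filter fun x => e x ∈ t, ?_, hmap⟩
    rw [mem_chainsOfCard, isChain_coe_iff]
    refine ⟨?_, ?_⟩
    · intro x hx y hy
      simp only [Finset.mem_filter, Finset.mem_univ, true_and] at hx hy
      simpa using ht.1.1 _ hx _ hy
    · rw [← Finset.card_map e.toEmbedding, hmap]
      exact ht.1.2

lemma chainCount_pos_iff [Finite P] {k : ℕ} :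
    0 < chainCount P k ↔ ∃ s ∈ orderComplex P, s.card = k := by
  cases nonempty_fintype P
  rw [chainCount_eq_card, Finset.card_pos]
  simp [Finset.Nonempty, mem_chainsOfCard, orderComplex]

lemma bddAbove_card_chains [Finite P] : BddAbove {k : ℕ | ∃ s ∈ orderComplex P, s.card = k} := by
  cases nonempty_fintype P
  refine ⟨Fintype.card P, ?_⟩
  rintro k ⟨s, _, rfl⟩
  exact Finset.card_le_univ s

lemma empty_mem_orderComplex : (∅ : Finset P) ∈ orderComplex P := by
  simp [orderComplex]

lemma chainCount_zero [Finite P] : chainCount P 0 = 1 := by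
  cases nonempty_fintype P
  rw [chainCount_eq_card, Finset.card_eq_one]
  refine ⟨∅, ?_⟩
  ext s
  simp only [mem_chainsOfCard, Finset.card_eq_zero, Finset.mem_singleton]
  constructor
  · exact fun h => h.2
  · rintro rfl
    simp

lemma chainCount_maxChainCard_pos [Finite P] : 0 < chainCount P (maxChainCard P) := by
  rw [chainCount_pos_iff]
  exact Nat.sSup_mem (s := {k : ℕ | ∃ s ∈ orderComplex P, s.card = k})
    ⟨0, ∅, empty_mem_orderComplex, rfl⟩ bddAbove_card_chains

lemma card_le_maxChainCard [Finite P] {s : Finset P} (hs : s ∈ orderComplex P) :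
    s.card ≤ maxChainCard P :=
  le_csSup bddAbove_card_chains ⟨s, hs, rfl⟩

lemma chainCount_eq_zero_of_lt [Finite P] {k : ℕ} (h : maxChainCard P < k) :
    chainCount P k = 0 := by
  by_contra hk
  obtain ⟨s, hs, rfl⟩ := chainCount_pos_iff.1 (Nat.pos_of_ne_zero hk)
  exact absurd (card_le_maxChainCard hs) (by omega)

lemma maxChainCard_eq [Finite P] {N : ℕ} (h : 0 < chainCount P N)
    (h' : ∀ k, N < k → chainCount P k = 0) : maxChainCard P = N := by
  apply le_antisymm
  · by_contra hlt
    have := h' _ (not_le.1 hlt)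
    have := chainCount_maxChainCard_pos (P := P)
    omega
  · by_contra hlt
    have := chainCount_eq_zero_of_lt (not_le.1 hlt)
    omega

lemma maxChainCard_pos [Finite P] [Nonempty P] : 0 < maxChainCard P := by
  obtain ⟨x⟩ := ‹Nonempty P›
  have h : ({x} : Finset P) ∈ orderComplex P := by simp [orderComplex]
  exact Nat.pos_of_ne_zero fun h0 => by simpa [h0] using card_le_maxChainCard h

/-- If `a` is comparable to every element of `P`, a chain of `P` is a chain of `P ∖ {a}`, with or
without `a` added. -/
lemma chainCount_succ_of_cone [Finite P] [Finite Q] (e : Q ↪o P) (a : P)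
    (hr : ∀ x, x ∈ Set.range e ↔ x ≠ a) (ha : ∀ x, a ≤ x ∨ x ≤ a) (k : ℕ) :
    chainCount P (k + 1) = chainCount Q (k + 1) + chainCount Q k := by
  classical
  cases nonempty_fintype P
  rw [chainCount_eq_of_embedding e, chainCount_eq_of_embedding e, chainCount_eq_card,
    ← Finset.card_filter_add_card_filter_not (s := chainsOfCard P (k + 1))
      (fun s => ∀ x ∈ s, x ∈ Set.range e)]
  congr 1
  symm
  have hiff : ∀ s : Finset P, (∀ x ∈ s, x ∈ Set.range e) ↔ a ∉ s := by
    intro s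
    simp only [hr]
    exact ⟨fun h h' => h a h' rfl, fun h x hx hxa => h (hxa ▸ hx)⟩
  simp only [hiff, not_not]
  refine Finset.card_bij' (fun s _ => insert a s) (fun s _ => s.erase a) ?_ ?_ ?_ ?_
  · intro s hs
    simp only [Finset.mem_filter, mem_chainsOfCard] at hs ⊢
    refine ⟨⟨?_, ?_⟩, Finset.mem_insert_self _ _⟩
    · rw [Finset.coe_insert]
      exact hs.1.1.insert fun b _ _ => ha b
    · rw [Finset.card_insert_of_notMem hs.2, hs.1.2]
  · intro s hs
    simp only [Finset.mem_filter, mem_chainsOfCard] at hs ⊢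
    refine ⟨⟨hs.1.1.mono (by simp), ?_⟩, Finset.notMem_erase _ _⟩
    rw [Finset.card_erase_of_mem hs.2, hs.1.2]
    rfl
  · intro s hs
    simp only [Finset.mem_filter] at hs
    exact Finset.erase_insert hs.2
  · intro s hs
    simp only [Finset.mem_filter] at hs
    exact Finset.insert_erase hs.2

lemma maxChainCard_of_cone [Finite P] [Finite Q] (e : Q ↪o P) (a : P)
    (hr : ∀ x, x ∈ Set.range e ↔ x ≠ a) (ha : ∀ x, a ≤ x ∨ x ≤ a) :
    maxChainCard P = maxChainCard Q + 1 := by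
  apply maxChainCard_eq
  · rw [chainCount_succ_of_cone e a hr ha]
    have := chainCount_maxChainCard_pos (P := Q)
    omega
  · intro k hk
    obtain ⟨k, rfl⟩ : ∃ j, k = j + 1 := ⟨k - 1, by omega⟩
    rw [chainCount_succ_of_cone e a hr ha, chainCount_eq_zero_of_lt (by omega),
      chainCount_eq_zero_of_lt (by omega)]

/-- The `h`-polynomial does not change when a cone point is removed. -/
lemma hPoly_of_cone [Finite P] [Finite Q] (e : Q ↪o P) (a : P)
    (hr : ∀ x, x ∈ Set.range e ↔ x ≠ a) (ha : ∀ x, a ≤ x ∨ x ≤ a) : hPoly P = hPoly Q := by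
  rw [hPoly, hPoly, maxChainCard_of_cone e a hr ha]
  set N := maxChainCard Q
  rw [Finset.sum_range_succ']
  simp only [chainCount_succ_of_cone e a hr ha, Nat.cast_add, C_add, add_mul,
    Finset.sum_add_distrib]
  -- Chains of `P` avoiding the cone point, the empty one included, contribute (1 - x) h_Q; the
  -- chains through it contribute x h_Q.
  have h1 : ∑ i ∈ Finset.range (N + 1),
        C (chainCount Q (i + 1) : ℝ) * X ^ (i + 1) * (1 - X) ^ (N + 1 - (i + 1)) +
      C (chainCount P 0 : ℝ) * X ^ 0 * (1 - X) ^ (N + 1 - 0) =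
      ∑ i ∈ Finset.range (N + 1), C (chainCount Q i : ℝ) * X ^ i * (1 - X) ^ (N - i) * (1 - X) := by
    rw [show chainCount P 0 = chainCount Q 0 by rw [chainCount_zero, chainCount_zero]]
    have := Finset.sum_range_succ'
      (fun i => C (chainCount Q i : ℝ) * X ^ i * (1 - X) ^ (N + 1 - i)) (N + 1)
    rw [← this, Finset.sum_range_succ, chainCount_eq_zero_of_lt (Nat.lt_succ_self N)]
    simp only [Nat.cast_zero, C_0, zero_mul, add_zero]
    refine Finset.sum_congr rfl fun i hi => ?_
    rw [Nat.succ_sub (by simpa [Nat.lt_succ_iff] using hi), pow_succ]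
    ring
  rw [add_right_comm, h1, ← Finset.sum_add_distrib]
  refine Finset.sum_congr rfl fun i _ => ?_
  rw [Nat.add_sub_add_right]
  ring

end Counting

/-! ### Chains of `P × C₂`. -/

section ProductWithChain

variable {P : Type*} [PartialOrder P]

open Classical in
/-- The chain of `P × C₂` over the chain `s` of `P` that switches to the upper level after `x`. -/
noncomputable def cutAfter (s : Finset P) (x : P) : Finset (P × Fin 2) :=
  s.image fun y => (y, if y ≤ x then 0 else 1)

open Classical in
/-- The chain of `P × C₂` over the chain `s` of `P` that switches to the upper level at `x`,
and has `x` on both levels. -/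
noncomputable def cutAt (s : Finset P) (x : P) : Finset (P × Fin 2) :=
  insert (x, 1) (cutAfter s x)

lemma mem_cutAfter_zero {s : Finset P} {x y : P} : (y, 0) ∈ cutAfter s x ↔ y ∈ s ∧ y ≤ x := by
  simp only [cutAfter, Finset.mem_image, Prod.mk.injEq]
  constructor
  · rintro ⟨z, hz, rfl, h⟩
    refine ⟨hz, ?_⟩
    by_contra hn
    simp [hn] at h
  · rintro ⟨h1, h2⟩
    exact ⟨y, h1, rfl, by simp [h2]⟩

lemma mem_cutAfter_one {s : Finset P} {x y : P} : (y, 1) ∈ cutAfter s x ↔ y ∈ s ∧ ¬ y ≤ x := by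
  simp only [cutAfter, Finset.mem_image, Prod.mk.injEq]
  constructor
  · rintro ⟨z, hz, rfl, h⟩
    refine ⟨hz, ?_⟩
    intro hn
    simp [hn] at h
  · rintro ⟨h1, h2⟩
    exact ⟨y, h1, rfl, by simp [h2]⟩

lemma mem_cutAt_zero {s : Finset P} {x y : P} : (y, 0) ∈ cutAt s x ↔ y ∈ s ∧ y ≤ x := by
  simp [cutAt, mem_cutAfter_zero]

lemma mem_cutAt_one {s : Finset P} {x y : P} :
    (y, 1) ∈ cutAt s x ↔ y = x ∨ y ∈ s ∧ ¬ y ≤ x := by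
  simp [cutAt, mem_cutAfter_one]

lemma card_cutAfter (s : Finset P) (x : P) : (cutAfter s x).card = s.card := by
  classical
  refine Finset.card_image_of_injective _ fun y z h => ?_
  exact (Prod.mk.inj h).1

lemma card_cutAt {s : Finset P} {x : P} : (cutAt s x).card = s.card + 1 := by
  classical
  rw [cutAt, Finset.card_insert_of_notMem, card_cutAfter]
  simp [mem_cutAfter_one]

lemma isChain_prod_fin_two_iff {T : Finset (P × Fin 2)} :
    IsChain (· ≤ ·) (T : Set (P × Fin 2)) ↔
      (∀ i, ∀ x y, (x, i) ∈ T → (y, i) ∈ T → x ≤ y ∨ y ≤ x) ∧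
        ∀ x y, (x, 0) ∈ T → (y, 1) ∈ T → x ≤ y := by
  rw [isChain_coe_iff]
  constructor
  · intro h
    refine ⟨fun i x y hx hy => by simpa using h _ hx _ hy, fun x y hx hy => ?_⟩
    have := h _ hx _ hy
    simpa [Prod.le_def] using this
  · rintro ⟨h1, h2⟩ ⟨x, i⟩ hx ⟨y, j⟩ hy
    have h3 := h1 0 x y
    have h4 := h1 1 x y
    have h5 := h2 x y
    have h6 := h2 y x
    fin_cases i <;> fin_cases j <;> simp_all [Prod.le_def]

lemma isChain_cutAfter {s : Finset P} (hs : IsChain (· ≤ ·) (s : Set P)) {x : P} (hx : x ∈ s) :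
    IsChain (· ≤ ·) (cutAfter s x : Set (P × Fin 2)) := by
  rw [isChain_coe_iff] at hs
  rw [isChain_prod_fin_two_iff]
  refine ⟨fun i y z hy hz => ?_, fun y z hy hz => ?_⟩
  · obtain rfl | rfl : i = 0 ∨ i = 1 := by omega
    · rw [mem_cutAfter_zero] at hy hz
      exact hs _ hy.1 _ hz.1
    · rw [mem_cutAfter_one] at hy hz
      exact hs _ hy.1 _ hz.1
  · rw [mem_cutAfter_zero] at hy
    rw [mem_cutAfter_one] at hz
    exact hy.2.trans ((hs _ hx _ hz.1).resolve_right hz.2)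

lemma isChain_cutAt {s : Finset P} (hs : IsChain (· ≤ ·) (s : Set P)) {x : P} (hx : x ∈ s) :
    IsChain (· ≤ ·) (cutAt s x : Set (P × Fin 2)) := by
  classical
  rw [cutAt, Finset.coe_insert]
  refine (isChain_cutAfter hs hx).insert ?_
  rintro ⟨y, i⟩ hy -
  rw [isChain_coe_iff] at hs
  obtain rfl | rfl : i = 0 ∨ i = 1 := by omega
  · rw [Finset.mem_coe, mem_cutAfter_zero] at hy
    exact Or.inr (by simpa [Prod.le_def] using hy.2)
  · rw [Finset.mem_coe, mem_cutAfter_one] at hy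
    simpa [Prod.le_def] using hs _ hx _ hy.1

omit [PartialOrder P] in
lemma ext_fin_two {T T' : Finset (P × Fin 2)} (h0 : ∀ y, (y, 0) ∈ T ↔ (y, 0) ∈ T')
    (h1 : ∀ y, (y, 1) ∈ T ↔ (y, 1) ∈ T') : T = T' := by
  ext ⟨y, i⟩
  obtain rfl | rfl : i = 0 ∨ i = 1 := by omega
  · exact h0 y
  · exact h1 y

lemma exists_max_on_lower {T : Finset (P × Fin 2)}
    (hT : IsChain (· ≤ ·) (T : Set (P × Fin 2))) (h : ∃ x, (x, 0) ∈ T) :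
    ∃ x, (x, 0) ∈ T ∧ ∀ y, (y, 0) ∈ T → y ≤ x := by
  classical
  rw [isChain_prod_fin_two_iff] at hT
  obtain ⟨x, hx⟩ := h
  obtain ⟨m, hm⟩ := ((T.filter fun p => p.2 = 0).image Prod.fst).exists_maximal
    ⟨x, by simpa using hx⟩
  have hmem : ∀ y, y ∈ (T.filter fun p => p.2 = 0).image Prod.fst ↔ (y, 0) ∈ T := by
    intro y
    simp
  refine ⟨m, (hmem m).1 hm.1, fun y hy => ?_⟩
  rcases hT.1 0 _ _ hy ((hmem m).1 hm.1) with h | h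
  · exact h
  · exact hm.2 ((hmem y).2 hy) h

-- Such chains correspond to `k`-element chains of `P` with a marked element: project to `P` and
-- mark the greatest element of the lower level.
open Classical in
lemma card_chains_disjoint_levels [Fintype P] (k : ℕ) :
    (((chainsOfCard (P × Fin 2) k).filter fun T => (∃ x, (x, 0) ∈ T) ∧
      ¬ ∃ x, (x, 0) ∈ T ∧ (x, 1) ∈ T)).card = k * chainCount P k := by
  have hcard : ((chainsOfCard P k).sigma fun s => s).card = k * chainCount P k := by
    rw [Finset.card_sigma, Finset.sum_congr rfl fun s hs => (mem_chainsOfCard.1 hs).2,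
      Finset.sum_const, smul_eq_mul, mul_comm, chainCount_eq_card]
  rw [← hcard]
  symm
  refine Finset.card_bij (fun p _ => cutAfter p.1 p.2) ?_ ?_ ?_
  · rintro ⟨s, x⟩ h
    simp only [Finset.mem_sigma, mem_chainsOfCard] at h
    simp only [Finset.mem_filter, mem_chainsOfCard, card_cutAfter, mem_cutAfter_zero,
      mem_cutAfter_one]
    exact ⟨⟨isChain_cutAfter h.1.1 h.2, h.1.2⟩, ⟨x, h.2, le_rfl⟩, fun ⟨y, h1, h2⟩ => h2.2 h1.2⟩
  · rintro ⟨s, x⟩ h ⟨s', x'⟩ h' heq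
    simp only [Finset.mem_sigma, mem_chainsOfCard] at h h' heq
    have h0 : ∀ y, y ∈ s ∧ y ≤ x ↔ y ∈ s' ∧ y ≤ x' := by
      intro y
      rw [← mem_cutAfter_zero, ← mem_cutAfter_zero, heq]
    have h1 : ∀ y, y ∈ s ∧ ¬ y ≤ x ↔ y ∈ s' ∧ ¬ y ≤ x' := by
      intro y
      rw [← mem_cutAfter_one, ← mem_cutAfter_one, heq]
    obtain rfl : x = x' := le_antisymm ((h0 x).1 ⟨h.2, le_rfl⟩).2 ((h0 x').2 ⟨h'.2, le_rfl⟩).2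
    obtain rfl : s = s' := by
      ext y
      have := h0 y
      have := h1 y
      tauto
    rfl
  · intro T hT
    simp only [Finset.mem_filter, mem_chainsOfCard] at hT
    obtain ⟨⟨hc, hk⟩, hne, hdis⟩ := hT
    obtain ⟨x, hx, hmax⟩ := exists_max_on_lower hc hne
    have hc' := isChain_prod_fin_two_iff.1 hc
    have hmem : ∀ y, y ∈ T.image Prod.fst ↔ (y, 0) ∈ T ∨ (y, 1) ∈ T := by
      intro y
      simp [Fin.exists_fin_two]
    have heq : cutAfter (T.image Prod.fst) x = T := by
      apply ext_fin_two
      · intro y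
        rw [mem_cutAfter_zero, hmem]
        constructor
        · rintro ⟨h | h, hy⟩
          · exact h
          · exact absurd ⟨x, hx, (le_antisymm hy (hc'.2 _ _ hx h)) ▸ h⟩ hdis
        · exact fun h => ⟨Or.inl h, hmax y h⟩
      · intro y
        rw [mem_cutAfter_one, hmem]
        constructor
        · rintro ⟨h | h, hy⟩
          · exact absurd (hmax y h) hy
          · exact h
        · exact fun h => ⟨Or.inr h, fun hy =>
            hdis ⟨x, hx, (le_antisymm hy (hc'.2 _ _ hx h)) ▸ h⟩⟩
    refine ⟨⟨T.image Prod.fst, x⟩, ?_, heq⟩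
    simp only [Finset.mem_sigma, mem_chainsOfCard]
    refine ⟨⟨?_, ?_⟩, (hmem x).2 (Or.inl hx)⟩
    · rw [isChain_coe_iff] at hc ⊢
      intro y hy z hz
      obtain ⟨p, hp, rfl⟩ := Finset.mem_image.1 hy
      obtain ⟨q, hq, rfl⟩ := Finset.mem_image.1 hz
      exact (hc p hp q hq).imp (fun h => h.1) (fun h => h.1)
    · rw [← card_cutAfter _ x, heq, hk]

-- The element present on both levels is unique, being at once the greatest on the lower level and
-- the least on the upper one. Projection merges its two copies, so a `k`-element chain with a
-- marked element is left.
open Classical in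
lemma card_chains_meeting_levels [Fintype P] (k : ℕ) :
    ((chainsOfCard (P × Fin 2) (k + 1)).filter fun T => ∃ x, (x, 0) ∈ T ∧ (x, 1) ∈ T).card =
      k * chainCount P k := by
  have hcard : ((chainsOfCard P k).sigma fun s => s).card = k * chainCount P k := by
    rw [Finset.card_sigma, Finset.sum_congr rfl fun s hs => (mem_chainsOfCard.1 hs).2,
      Finset.sum_const, smul_eq_mul, mul_comm, chainCount_eq_card]
  rw [← hcard]
  symm
  refine Finset.card_bij (fun p _ => cutAt p.1 p.2) ?_ ?_ ?_
  · rintro ⟨s, x⟩ h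
    simp only [Finset.mem_sigma, mem_chainsOfCard] at h
    simp only [Finset.mem_filter, mem_chainsOfCard, card_cutAt, mem_cutAt_zero, mem_cutAt_one]
    exact ⟨⟨isChain_cutAt h.1.1 h.2, by rw [h.1.2]⟩, x, ⟨h.2, le_rfl⟩, Or.inl rfl⟩
  · rintro ⟨s, x⟩ h ⟨s', x'⟩ h' heq
    simp only [Finset.mem_sigma, mem_chainsOfCard] at h h' heq
    have h0 : ∀ y, y ∈ s ∧ y ≤ x ↔ y ∈ s' ∧ y ≤ x' := by
      intro y
      rw [← mem_cutAt_zero, ← mem_cutAt_zero, heq]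
    have h1 : ∀ y, (y = x ∨ y ∈ s ∧ ¬ y ≤ x) ↔ (y = x' ∨ y ∈ s' ∧ ¬ y ≤ x') := by
      intro y
      rw [← mem_cutAt_one, ← mem_cutAt_one, heq]
    obtain rfl : x = x' := le_antisymm ((h0 x).1 ⟨h.2, le_rfl⟩).2 ((h0 x').2 ⟨h'.2, le_rfl⟩).2
    obtain rfl : s = s' := by
      ext y
      by_cases hy : y = x
      · subst hy
        exact ⟨fun _ => h'.2, fun _ => h.2⟩
      · have := h0 y
        have := h1 y
        tauto
    rfl
  · intro T hT
    simp only [Finset.mem_filter, mem_chainsOfCard] at hT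
    obtain ⟨⟨hc, hk⟩, x, hx, hx1⟩ := hT
    have hc' := isChain_prod_fin_two_iff.1 hc
    have hmem : ∀ y, y ∈ T.image Prod.fst ↔ (y, 0) ∈ T ∨ (y, 1) ∈ T := by
      intro y
      simp [Fin.exists_fin_two]
    have heq : cutAt (T.image Prod.fst) x = T := by
      apply ext_fin_two
      · intro y
        rw [mem_cutAt_zero, hmem]
        constructor
        · rintro ⟨h | h, hy⟩
          · exact h
          · exact (le_antisymm hy (hc'.2 _ _ hx h)) ▸ hx
        · exact fun h => ⟨Or.inl h, hc'.2 _ _ h hx1⟩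
      · intro y
        rw [mem_cutAt_one, hmem]
        constructor
        · rintro (rfl | ⟨h | h, hy⟩)
          · exact hx1
          · exact absurd (hc'.2 _ _ h hx1) hy
          · exact h
        · intro h
          by_cases hy : y ≤ x
          · exact Or.inl (le_antisymm hy (hc'.2 _ _ hx h))
          · exact Or.inr ⟨Or.inr h, hy⟩
    refine ⟨⟨T.image Prod.fst, x⟩, ?_, heq⟩
    simp only [Finset.mem_sigma, mem_chainsOfCard]
    refine ⟨⟨?_, ?_⟩, (hmem x).2 (Or.inl hx)⟩
    · rw [isChain_coe_iff] at hc ⊢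
      intro y hy z hz
      obtain ⟨p, hp, rfl⟩ := Finset.mem_image.1 hy
      obtain ⟨q, hq, rfl⟩ := Finset.mem_image.1 hz
      exact (hc p hp q hq).imp (fun h => h.1) (fun h => h.1)
    · have := card_cutAt (s := T.image Prod.fst) (x := x)
      rw [heq, hk] at this
      omega

/-- The embedding of `P` as the upper level of `P × C₂`. -/
def upperLevel (P : Type*) [PartialOrder P] : P ↪o P × Fin 2 :=
  OrderEmbedding.ofMapLEIff (fun x => (x, 1)) fun x y => by simp

/-- Three kinds of chains: contained in the upper level; meeting the lower level with no element
repeated; with a repeated element. They number c_{k+1}, (k+1) c_{k+1} and k c_k. -/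
lemma chainCount_prod_fin_two_succ [Finite P] (k : ℕ) :
    chainCount (P × Fin 2) (k + 1) = (k + 2) * chainCount P (k + 1) + k * chainCount P k := by
  classical
  cases nonempty_fintype P
  have h1 := chainCount_eq_of_embedding (upperLevel P) (k + 1)
  have hiff : ∀ T : Finset (P × Fin 2),
      (∀ p ∈ T, p ∈ Set.range (upperLevel P)) ↔ ¬ ∃ x, (x, 0) ∈ T := by
    intro T
    have hr : ∀ p, p ∈ Set.range (upperLevel P) ↔ p.2 = 1 := by
      rintro ⟨x, i⟩
      simp [upperLevel, eq_comm]
    simp only [hr]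
    constructor
    · rintro h ⟨x, hx⟩
      simpa using h _ hx
    · rintro h ⟨x, i⟩ hp
      obtain rfl | rfl : i = 0 ∨ i = 1 := by omega
      · exact absurd ⟨x, hp⟩ h
      · rfl
  simp only [hiff] at h1
  rw [chainCount_eq_card, ← Finset.card_filter_add_card_filter_not
    (s := chainsOfCard (P × Fin 2) (k + 1)) (fun T => ∃ x, (x, 0) ∈ T), ← h1,
    ← Finset.card_filter_add_card_filter_not
    (s := (chainsOfCard (P × Fin 2) (k + 1)).filter fun T => ∃ x, (x, 0) ∈ T)
    (fun T => ∃ x, (x, 0) ∈ T ∧ (x, 1) ∈ T), Finset.filter_filter, Finset.filter_filter,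
    card_chains_disjoint_levels]
  have h2 : ((chainsOfCard (P × Fin 2) (k + 1)).filter fun T =>
      (∃ x, (x, 0) ∈ T) ∧ ∃ x, (x, 0) ∈ T ∧ (x, 1) ∈ T) =
      (chainsOfCard (P × Fin 2) (k + 1)).filter fun T => ∃ x, (x, 0) ∈ T ∧ (x, 1) ∈ T := by
    refine Finset.filter_congr fun T _ => ?_
    exact ⟨fun h => h.2, fun h => ⟨h.imp fun x hx => hx.1, h⟩⟩
  rw [h2, card_chains_meeting_levels]
  ring

lemma maxChainCard_prod_fin_two [Finite P] [Nonempty P] :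
    maxChainCard (P × Fin 2) = maxChainCard P + 1 := by
  apply maxChainCard_eq
  · rw [chainCount_prod_fin_two_succ]
    have := Nat.mul_pos (maxChainCard_pos (P := P)) (chainCount_maxChainCard_pos (P := P))
    omega
  · intro k hk
    obtain ⟨k, rfl⟩ : ∃ j, k = j + 1 := ⟨k - 1, by omega⟩
    rw [chainCount_prod_fin_two_succ, chainCount_eq_zero_of_lt (by omega),
      chainCount_eq_zero_of_lt (by omega)]
    simp

/-- The logarithmic derivative i/x - (N-i)/(1-x), multiplied by x(1-x), is i - Nx. -/
lemma derivative_basis_term (N i : ℕ) (hi : i ≤ N) (c : ℝ) :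
    (X - X ^ 2) * derivative (C c * X ^ i * (1 - X) ^ (N - i)) =
      C c * X ^ i * (1 - X) ^ (N - i) * ((i : ℝ[X]) - (N : ℝ[X]) * X) := by
  obtain ⟨j, rfl⟩ := Nat.exists_eq_add_of_le hi
  rw [Nat.add_sub_cancel_left]
  simp only [derivative_mul, derivative_C, derivative_pow, derivative_sub,
    derivative_one, derivative_X, zero_mul, zero_add, map_natCast, Nat.cast_add]
  -- Zero exponents are separated because the derivative contains the truncated exponents `i - 1`
  -- and `j - 1`.
  rcases i with _ | i <;> rcases j with _ | j <;>
    simp only [Nat.cast_zero, zero_mul, mul_zero, Nat.add_sub_cancel, Nat.cast_add,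
      Nat.cast_one, pow_succ, pow_zero] <;> ring

lemma hPoly_prod_fin_two [Finite P] [Nonempty P] :
    hPoly (P × Fin 2) = (1 + ((maxChainCard P : ℝ[X]) - 1) * X) * hPoly P
      + (X - X ^ 2) * derivative (hPoly P) := by
  rw [hPoly, hPoly, maxChainCard_prod_fin_two]
  set N := maxChainCard P
  rw [derivative_sum, Finset.mul_sum, Finset.mul_sum, ← Finset.sum_add_distrib,
    Finset.sum_range_succ']
  -- Index shift: the empty chain supplies the term i = 0, and the new top term vanishes since
  -- c_{N+1}(P) = 0.
  have h1 : ∑ i ∈ Finset.range (N + 1),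
        C ((i + 2) * chainCount P (i + 1) : ℝ) * X ^ (i + 1) * (1 - X) ^ (N + 1 - (i + 1)) +
      C (chainCount (P × Fin 2) 0 : ℝ) * X ^ 0 * (1 - X) ^ (N + 1 - 0) =
      ∑ i ∈ Finset.range (N + 1),
        C ((i + 1) * chainCount P i : ℝ) * X ^ i * (1 - X) ^ (N - i) * (1 - X) := by
    have := Finset.sum_range_succ'
      (fun i : ℕ => C ((i + 1) * chainCount P i : ℝ) * X ^ i * (1 - X) ^ (N + 1 - i)) (N + 1)
    simp only [chainCount_zero, Nat.cast_zero, Nat.cast_add, Nat.cast_one, zero_add, one_mul,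
      add_assoc, one_add_one_eq_two] at this ⊢
    rw [← this, show N + 2 = N + 1 + 1 from rfl, Finset.sum_range_succ _ (N + 1),
      chainCount_eq_zero_of_lt (Nat.lt_succ_self N)]
    simp only [Nat.cast_zero, C_0, mul_zero, zero_mul, add_zero]
    refine Finset.sum_congr rfl fun i hi => ?_
    rw [Nat.succ_sub (by simpa [Nat.lt_succ_iff] using hi), pow_succ]
    ring
  have h2 : ∀ i : ℕ, (chainCount (P × Fin 2) (i + 1) : ℝ) =
      (i + 2) * chainCount P (i + 1) + i * chainCount P i := by
    intro i
    rw [chainCount_prod_fin_two_succ]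
    push_cast
    ring
  have h3 : ∑ i ∈ Finset.range (N + 1),
        C (chainCount (P × Fin 2) (i + 1) : ℝ) * X ^ (i + 1) * (1 - X) ^ (N + 1 - (i + 1)) =
      ∑ i ∈ Finset.range (N + 1),
        C ((i + 2) * chainCount P (i + 1) : ℝ) * X ^ (i + 1) * (1 - X) ^ (N + 1 - (i + 1)) +
      ∑ i ∈ Finset.range (N + 1),
        C (i * chainCount P i : ℝ) * X ^ (i + 1) * (1 - X) ^ (N + 1 - (i + 1)) := by
    rw [← Finset.sum_add_distrib]
    refine Finset.sum_congr rfl fun i _ => ?_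
    rw [h2, C_add]
    ring
  rw [h3, add_right_comm, h1, ← Finset.sum_add_distrib]
  refine Finset.sum_congr rfl fun i hi => ?_
  rw [derivative_basis_term N i (by simpa [Nat.lt_succ_iff] using hi), Nat.add_sub_add_right]
  simp only [C_mul, C_add, C_1, map_natCast]
  ring

end ProductWithChain

end ChainPoly

namespace ChainPoly

/-! ### Inclusion–exclusion for the product with `Vee`. -/

section ProductWithVee

variable {Q : Type*} [PartialOrder Q]

/-- The three-element poset of nonzero elements of `C₂ × C₂`. -/
abbrev Vee : Type := {y : Fin 2 × Fin 2 // y ≠ ⊥}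

/-- One of the two maximal chains of `Vee`, multiplied by `Q`. -/
def veeLeft (Q : Type*) [PartialOrder Q] : Q × Fin 2 ↪o Q × Vee :=
  OrderEmbedding.ofMapLEIff
    (fun p => (p.1, ⟨(p.2, 1), fun h => one_ne_zero (congrArg Prod.snd h : (1 : Fin 2) = 0)⟩))
    fun p q => by simp [Prod.le_def]

/-- The other maximal chain of `Vee`, multiplied by `Q`. -/
def veeRight (Q : Type*) [PartialOrder Q] : Q × Fin 2 ↪o Q × Vee :=
  OrderEmbedding.ofMapLEIff
    (fun p => (p.1, ⟨(1, p.2), fun h => one_ne_zero (congrArg Prod.fst h : (1 : Fin 2) = 0)⟩))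
    fun p q => by simp [Prod.le_def]

/-- The maximum of `Vee`, multiplied by `Q`. -/
def veeTop (Q : Type*) [PartialOrder Q] : Q ↪o Q × Vee :=
  OrderEmbedding.ofMapLEIff
    (fun x => (x, ⟨(1, 1), fun h => one_ne_zero (congrArg Prod.fst h : (1 : Fin 2) = 0)⟩))
    fun p q => by simp [Prod.le_def]

lemma mem_range_veeLeft (p : Q × Vee) : p ∈ Set.range (veeLeft Q) ↔ p.2.1.2 = 1 := by
  obtain ⟨x, ⟨⟨i, j⟩, h⟩⟩ := p
  simp [veeLeft, eq_comm]

lemma mem_range_veeRight (p : Q × Vee) : p ∈ Set.range (veeRight Q) ↔ p.2.1.1 = 1 := by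
  obtain ⟨x, ⟨⟨i, j⟩, h⟩⟩ := p
  simp [veeRight, eq_comm]

lemma mem_range_veeTop (p : Q × Vee) :
    p ∈ Set.range (veeTop Q) ↔ p.2.1.2 = 1 ∧ p.2.1.1 = 1 := by
  obtain ⟨x, ⟨⟨i, j⟩, h⟩⟩ := p
  simp [veeTop, eq_comm, and_comm]

lemma chainCount_prod_vee [Finite Q] (k : ℕ) :
    chainCount (Q × Vee) k + chainCount Q k = 2 * chainCount (Q × Fin 2) k := by
  classical
  cases nonempty_fintype Q
  have h1 := chainCount_eq_of_embedding (veeLeft Q) k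
  have h2 := chainCount_eq_of_embedding (veeRight Q) k
  have h0 := chainCount_eq_of_embedding (veeTop Q) k
  simp only [mem_range_veeLeft, mem_range_veeRight, mem_range_veeTop] at h0 h1 h2
  have hi := Finset.card_union_add_card_inter
    ((chainsOfCard (Q × Vee) k).filter fun s => ∀ p ∈ s, p.2.1.2 = 1)
    ((chainsOfCard (Q × Vee) k).filter fun s => ∀ p ∈ s, p.2.1.1 = 1)
  rw [← Finset.filter_or, ← Finset.filter_and, ← h1, ← h2] at hi
  simp only [← forall₂_and] at hi
  rw [← h0, Finset.filter_true_of_mem, ← chainCount_eq_card] at hi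
  · omega
  · intro s hs
    rw [mem_chainsOfCard, isChain_coe_iff] at hs
    -- A chain in neither half would have a point over (1, 0) and a point over (0, 1), which are
    -- incomparable.
    by_contra hcon
    push Not at hcon
    obtain ⟨⟨⟨x, ⟨⟨i, j⟩, hij⟩⟩, hp, hj⟩, ⟨⟨y, ⟨⟨i', j'⟩, hij'⟩⟩, hq, hi'⟩⟩ := hcon
    have h := hs.1 _ hp _ hq
    simp only [Prod.le_def, Subtype.mk_le_mk] at h hj hi'
    have e1 : ¬ (i = 0 ∧ j = 0) := fun h => hij (by rw [h.1, h.2]; rfl)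
    have e2 : ¬ (i' = 0 ∧ j' = 0) := fun h => hij' (by rw [h.1, h.2]; rfl)
    simp only [Fin.le_def] at h
    omega

lemma maxChainCard_prod_vee [Finite Q] [Nonempty Q] :
    maxChainCard (Q × Vee) = maxChainCard Q + 1 := by
  have hN := maxChainCard_prod_fin_two (P := Q)
  apply maxChainCard_eq
  · have h1 := chainCount_prod_vee (Q := Q) (maxChainCard Q + 1)
    rw [chainCount_eq_zero_of_lt (P := Q) (Nat.lt_succ_self _)] at h1
    have h2 := chainCount_maxChainCard_pos (P := Q × Fin 2)
    rw [hN] at h2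
    omega
  · intro k hk
    have h1 := chainCount_prod_vee (Q := Q) k
    rw [chainCount_eq_zero_of_lt (P := Q × Fin 2) (by omega)] at h1
    omega

/-- The factor 1 - x compensates for the longest chains of `Q` being one element shorter than those
of the two products. -/
lemma hPoly_prod_vee [Finite Q] [Nonempty Q] :
    hPoly (Q × Vee) = 2 * hPoly (Q × Fin 2) - (1 - X) * hPoly Q := by
  have h : ∀ k, (chainCount (Q × Vee) k : ℝ) =
      2 * chainCount (Q × Fin 2) k - chainCount Q k := by
    intro k
    have : ((chainCount (Q × Vee) k + chainCount Q k : ℕ) : ℝ) =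
      ((2 * chainCount (Q × Fin 2) k : ℕ) : ℝ) := by rw [chainCount_prod_vee]
    push_cast at this
    linarith
  have h1 : (1 - X) * hPoly Q = ∑ i ∈ Finset.range (maxChainCard Q + 1 + 1),
      C (chainCount Q i : ℝ) * X ^ i * (1 - X) ^ (maxChainCard Q + 1 - i) := by
    rw [Finset.sum_range_succ, chainCount_eq_zero_of_lt (Nat.lt_succ_self _), hPoly,
      Finset.mul_sum]
    simp only [Nat.cast_zero, C_0, zero_mul, add_zero]
    refine Finset.sum_congr rfl fun i hi => ?_
    rw [Nat.succ_sub (by simpa [Nat.lt_succ_iff] using hi), pow_succ]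
    ring
  rw [h1, hPoly, hPoly, maxChainCard_prod_vee, maxChainCard_prod_fin_two, Finset.mul_sum,
    ← Finset.sum_sub_distrib]
  refine Finset.sum_congr rfl fun i _ => ?_
  rw [h, C_sub, C_mul]
  simp only [map_ofNat]
  ring

end ProductWithVee

/-! ### Graded posets: purity, the formulas of (a), the degree bound. -/

section Graded

variable {L : Type*} [PartialOrder L] [BoundedOrder L] [Finite L]

omit [BoundedOrder L] in
lemma strictMono_of_covBy_rank {ρ : L → ℕ} (h : ∀ a b : L, a ⋖ b → ρ b = ρ a + 1) :
    StrictMono ρ := by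
  classical
  cases nonempty_fintype L
  let _ : LocallyFiniteOrder L := Fintype.toLocallyFiniteOrder
  rw [strictMono_iff_forall_covBy]
  intro a b hab
  rw [h a b hab]
  exact Nat.lt_succ_self _

open Classical in
/-- A chain of a graded poset of rank `n` that has at most `n` elements is not maximal. -/
lemma exists_insert_mem_orderComplex {n : ℕ} (hL : IsGradedOfRank L n) {F : Finset L}
    (hF : F ∈ orderComplex L) (hcard : F.card < n + 1) :
    ∃ c ∉ F, insert c F ∈ orderComplex L := by
  obtain ⟨ρ, hbot, htop, hcov⟩ := hL
  have hmono := strictMono_of_covBy_rank hcov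
  have hins : ∀ c : L, (∀ x ∈ F, c ≤ x ∨ x ≤ c) → insert c F ∈ orderComplex L := by
    intro c hc
    rw [orderComplex, Set.mem_ofPred_eq, Finset.coe_insert]
    exact IsChain.insert hF fun b hb _ => hc b hb
  by_cases hb : ⊥ ∈ F
  swap
  · exact ⟨⊥, hb, hins _ fun x _ => Or.inl bot_le⟩
  by_cases ht : ⊤ ∈ F
  swap
  · exact ⟨⊤, ht, hins _ fun x _ => Or.inr le_top⟩
  -- `F` misses some rank `r`. Its neighbours `a`, `b` around `r` differ in rank by at least 2, so
  -- `b` does not cover `a`, and any element strictly between them extends `F`, whatever its rank.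
  obtain ⟨r, hr, hrF⟩ : ∃ r ∈ Finset.range (n + 1), r ∉ F.image ρ := by
    apply Finset.exists_mem_notMem_of_card_lt_card
    exact (Finset.card_image_le).trans_lt (by simpa using hcard)
  have hne : ∀ x ∈ F, ρ x ≠ r := fun x hx h => hrF (Finset.mem_image.2 ⟨x, hx, h⟩)
  have hF' := isChain_coe_iff.1 hF
  have hb0 := hne _ hb
  have ht0 := hne _ ht
  rw [Finset.mem_range] at hr
  obtain ⟨a, ha, hamax⟩ := (F.filter fun x => ρ x < r).exists_max_image ρ
    ⟨⊥, Finset.mem_filter.2 ⟨hb, by omega⟩⟩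
  obtain ⟨b, hbm, hbmin⟩ := (F.filter fun x => r < ρ x).exists_min_image ρ
    ⟨⊤, Finset.mem_filter.2 ⟨ht, by omega⟩⟩
  simp only [Finset.mem_filter] at ha hbm hamax hbmin
  have hlow : ∀ x ∈ F, ρ x < r → x ≤ a := by
    intro x hx hxr
    rcases hF' x hx a ha.1 with h | h
    · exact h
    · rcases h.eq_or_lt with rfl | h
      · exact le_rfl
      · exact absurd (hamax x ⟨hx, hxr⟩) (not_le.2 (hmono h))
  have hupp : ∀ x ∈ F, r < ρ x → b ≤ x := by
    intro x hx hxr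
    rcases hF' b hbm.1 x hx with h | h
    · exact h
    · rcases h.eq_or_lt with rfl | h
      · exact le_rfl
      · exact absurd (hbmin x ⟨hx, hxr⟩) (not_le.2 (hmono h))
  have hab : a < b := by
    rcases hF' a ha.1 b hbm.1 with h | h
    · exact lt_of_le_of_ne h fun h => by rw [h] at ha; omega
    · have := hmono.monotone h
      omega
  have hncov : ¬ a ⋖ b := fun h => by
    have := hcov a b h
    omega
  obtain ⟨c, hac, hcb⟩ := (not_covBy_iff hab).1 hncov
  refine ⟨c, fun hc => ?_, hins c fun x hx => ?_⟩
  · rcases lt_or_gt_of_ne (hne c hc) with h | h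
    · exact (hac.trans_le (hlow c hc h)).false
    · exact (hcb.trans_le (hupp c hc h)).false
  · rcases lt_or_gt_of_ne (hne x hx) with h | h
    · exact Or.inr ((hlow x hx h).trans hac.le)
    · exact Or.inl (hcb.le.trans (hupp x hx h))

lemma card_le_of_isGradedOfRank {n : ℕ} (hL : IsGradedOfRank L n) {F : Finset L}
    (hF : F ∈ orderComplex L) : F.card ≤ n + 1 := by
  obtain ⟨ρ, hbot, htop, hcov⟩ := hL
  have hmono := strictMono_of_covBy_rank hcov
  have hinj : Set.InjOn ρ F := by
    intro x hx y hy hxy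
    rcases hF.total hx hy with h | h
    · exact h.eq_or_lt.resolve_right fun h => (hmono h).ne hxy
    · exact (h.eq_or_lt.resolve_right fun h => (hmono h).ne hxy.symm).symm
  have := Finset.card_le_card_of_injOn (t := Finset.range (n + 1)) ρ
    (fun x _ => by
      have := hmono.monotone (le_top (a := x))
      rw [htop] at this
      simpa [Nat.lt_succ_iff] using this) hinj
  simpa using this

/-- Every chain of a graded poset of rank `n` is contained in a chain with `n + 1` elements. -/
lemma exists_superset_card_eq {n : ℕ} (hL : IsGradedOfRank L n) {F : Finset L}
    (hF : F ∈ orderComplex L) : ∃ G ∈ orderComplex L, F ⊆ G ∧ G.card = n + 1 := by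
  classical
  have hle := card_le_of_isGradedOfRank hL hF
  obtain ⟨d, hd⟩ := Nat.exists_eq_add_of_le hle
  induction d generalizing F with
  | zero => exact ⟨F, hF, subset_rfl, by omega⟩
  | succ d ih =>
    obtain ⟨c, hc, hins⟩ := exists_insert_mem_orderComplex hL hF (by omega)
    have hcard := Finset.card_insert_of_notMem hc
    obtain ⟨G, hG, hsub, h⟩ := ih hins (by omega) (by omega)
    exact ⟨G, hG, (Finset.subset_insert _ _).trans hsub, h⟩

lemma maxChainCard_of_isGradedOfRank {n : ℕ} (hL : IsGradedOfRank L n) :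
    maxChainCard L = n + 1 := by
  obtain ⟨G, hG, -, h⟩ := exists_superset_card_eq hL (empty_mem_orderComplex (P := L))
  apply maxChainCard_eq
  · exact chainCount_pos_iff.2 ⟨G, hG, h⟩
  · intro k hk
    by_contra hk0
    obtain ⟨s, hs, rfl⟩ := chainCount_pos_iff.1 (Nat.pos_of_ne_zero hk0)
    have := card_le_of_isGradedOfRank hL hs
    omega

lemma hPoly_pyr {n : ℕ} (hL : IsGradedOfRank L n) :
    hPoly (Pyr L) = (1 + (n : ℝ[X]) * X) * hPoly L + (X - X ^ 2) * derivative (hPoly L) := by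
  rw [hPoly_prod_fin_two, maxChainCard_of_isGradedOfRank hL]
  push_cast
  ring

/-- The inclusion of `L ∖ {a}` in `L`. -/
def removePoint (L : Type*) [PartialOrder L] (a : L) : {x : L // x ≠ a} ↪o L :=
  OrderEmbedding.subtype _

lemma mem_range_removePoint {L : Type*} [PartialOrder L] (a x : L) :
    x ∈ Set.range (removePoint L a) ↔ x ≠ a := by
  simp [removePoint]

/-- The minima of `Prism L` and of `L` are both cone points, so everything is computed over `L ∖
{⊥}`, whose longest chains have `n` elements. -/
lemma hPoly_prism {n : ℕ} (hn : 0 < n) (hL : IsGradedOfRank L n) :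
    hPoly (Prism L) = (1 + (2 * (n : ℝ[X]) - 1) * X) * hPoly L
      + 2 * (X - X ^ 2) * derivative (hPoly L) := by
  have hN := maxChainCard_of_isGradedOfRank hL
  have h1 := hPoly_of_cone (removePoint L ⊥) ⊥ (mem_range_removePoint ⊥)
    (fun x => Or.inl bot_le)
  rw [maxChainCard_of_cone (removePoint L ⊥) ⊥ (mem_range_removePoint ⊥)
    (fun x => Or.inl bot_le), Nat.add_right_cancel_iff] at hN
  have : Nonempty {x : L // x ≠ ⊥} := by
    by_contra hne
    rw [not_nonempty_iff] at hne
    obtain ⟨s, hs, h⟩ := chainCount_pos_iff.1 (chainCount_maxChainCard_pos (P := {x : L // x ≠ ⊥}))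
    rw [Finset.eq_empty_of_isEmpty s] at h
    rw [Finset.card_empty, hN] at h
    omega
  change hPoly (WithBot ({x : L // x ≠ ⊥} × Vee)) = _
  rw [hPoly_of_cone (WithBot.coeOrderHom (α := {x : L // x ≠ ⊥} × Vee)) ⊥
    (fun x => by rw [WithBot.ne_bot_iff_exists]; rfl) (fun x => Or.inl bot_le),
    hPoly_prod_vee, hPoly_prod_fin_two, ← h1, hN]
  ring

/-- Both the minimum and the maximum are cone points, so that the degree drops by two. -/
lemma natDegree_hPoly_lt {n : ℕ} (hn : 0 < n) (hL : IsGradedOfRank L n) :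
    (hPoly L).natDegree < n := by
  have hdeg : ∀ (P : Type _) [PartialOrder P], (hPoly P).natDegree ≤ maxChainCard P := by
    intro P _
    rw [hPoly]
    refine natDegree_sum_le_of_forall_le _ _ fun i hi => ?_
    have hi : i ≤ maxChainCard P := by simpa [Nat.lt_succ_iff] using hi
    have h1 : (C (chainCount P i : ℝ) * X ^ i).natDegree ≤ i := natDegree_C_mul_X_pow_le _ _
    have h2 : ((1 - X : ℝ[X]) ^ (maxChainCard P - i)).natDegree ≤ maxChainCard P - i := by
      refine natDegree_pow_le_of_le _ ?_ |>.trans (Nat.mul_one _).le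
      exact (natDegree_sub_le _ _).trans (by simp)
    exact (natDegree_mul_le_of_le h1 h2).trans (by omega)
  have hN := maxChainCard_of_isGradedOfRank hL
  have hbt : (⊤ : L) ≠ ⊥ := by
    intro h
    have := subsingleton_of_bot_eq_top h.symm
    obtain ⟨ρ, h0, h1, -⟩ := hL
    rw [h, h0] at h1
    omega
  let t : {x : L // x ≠ ⊥} := ⟨⊤, hbt⟩
  have ht : ∀ x : {x : L // x ≠ ⊥}, t ≤ x ∨ x ≤ t := fun x => Or.inr (le_top (a := x.1))
  have hb : ∀ x : L, ⊥ ≤ x ∨ x ≤ ⊥ := fun x => Or.inl bot_le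
  rw [maxChainCard_of_cone (removePoint L ⊥) ⊥ (mem_range_removePoint ⊥) hb,
    maxChainCard_of_cone (removePoint _ t) t (mem_range_removePoint t) ht] at hN
  rw [hPoly_of_cone (removePoint L ⊥) ⊥ (mem_range_removePoint ⊥) hb,
    hPoly_of_cone (removePoint _ t) t (mem_range_removePoint t) ht]
  have := hdeg {x : {x : L // x ≠ ⊥} // x ≠ t}
  omega

end Graded

end ChainPoly

namespace ChainPoly

/-! ### The Euler–Poincaré formula. -/

section EulerPoincare

/-- The Euler–Poincaré formula for a complex that is exact except at its last place. -/
lemma sum_finrank_of_exact {V : Type*} [AddCommGroup V] [Module ℚ V] [FiniteDimensional ℚ V]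
    (d : V →ₗ[ℚ] V) (C : ℕ → Submodule ℚ V) (hmap : ∀ k, (C (k + 1)).map d ≤ C k)
    (hsq : ∀ k, ∀ v ∈ C k, d (d v) = 0) (h0 : ∀ v ∈ C 0, d v = 0) (m : ℕ)
    (hex : ∀ k < m, ∀ z ∈ C k, d z = 0 → ∃ w ∈ C (k + 1), d w = z) :
    ∑ k ∈ Finset.range (m + 1), (-1 : ℝ) ^ k * Module.finrank ℚ (C k) =
      (-1) ^ m * Module.finrank ℚ ↥(C m ⊓ LinearMap.ker d) := by
  have hrank : ∀ k, Module.finrank ℚ ((C k).map d) + Module.finrank ℚ ↥(C k ⊓ LinearMap.ker d) =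
      Module.finrank ℚ (C k) := by
    intro k
    rw [← LinearMap.finrank_range_add_finrank_ker (d.domRestrict (C k)),
      LinearMap.range_domRestrict, LinearMap.ker_domRestrict, ← Submodule.map_comap_subtype,
      Submodule.finrank_map_subtype_eq]
  induction m with
  | zero =>
    have hbot : (C 0).map d = ⊥ := by
      rw [eq_bot_iff]
      rintro _ ⟨v, hv, rfl⟩
      exact (Submodule.mem_bot ℚ).2 (h0 v hv)
    have := hrank 0
    rw [hbot, finrank_bot, zero_add] at this
    simp [this]
  | succ m ih =>
    rw [Finset.sum_range_succ, ih fun k hk => hex k (by omega)]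
    -- Exactness at place `m`: the cycles there are the image of `C (m + 1)`, so rank–nullity makes
    -- the alternating sum telescope.
    have himg : (C (m + 1)).map d = C m ⊓ LinearMap.ker d := by
      apply le_antisymm
      · refine le_inf (hmap m) ?_
        rintro _ ⟨v, hv, rfl⟩
        exact hsq _ v hv
      · rintro z ⟨hz, hz'⟩
        obtain ⟨w, hw, rfl⟩ := hex m (Nat.lt_succ_self m) z hz hz'
        exact ⟨w, hw, rfl⟩
    have := hrank (m + 1)
    rw [himg] at this
    rw [← this]
    push_cast
    ring

end EulerPoincare

/-! ### The simplicial chain complex of a family of chains. -/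

section Boundary

variable {P : Type*} [PartialOrder P]

open Classical in
lemma boundary_single (s : Finset P) :
    boundary P (Finsupp.single s 1) =
      ∑ x ∈ s, Finsupp.single (s.erase x) ((-1 : ℚ) ^ (s.filter (· < x)).card) := by
  simp [boundary]

-- Exchanging the two summations shows that the sum equals its negative.
omit [PartialOrder P] in
open Classical in
lemma sum_sum_erase_eq_zero {V : Type*} [AddCommGroup V] [IsAddTorsionFree V] (s : Finset P)
    (f : P → P → V) (h : ∀ x ∈ s, ∀ y ∈ s, x ≠ y → f x y = -f y x) :
    ∑ x ∈ s, ∑ y ∈ s.erase x, f x y = 0 := by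
  rw [← self_eq_neg, ← Finset.sum_neg_distrib]
  conv_lhs => rw [Finset.sum_comm' (t' := s) (s' := fun y => s.erase y)
    (by simp only [Finset.mem_erase]; tauto)]
  refine Finset.sum_congr rfl fun y hy => ?_
  rw [← Finset.sum_neg_distrib]
  refine Finset.sum_congr rfl fun x hx => ?_
  exact h x (Finset.mem_of_mem_erase hx) y hy (Finset.ne_of_mem_erase hx)

-- A face missing x < y arises twice, with opposite signs: deleting `x` first lowers the position of
-- `y` by one, while deleting `y` first leaves that of `x` unchanged.
open Classical in
lemma boundary_boundary_single {s : Finset P} (hs : s ∈ orderComplex P) :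
    boundary P (boundary P (Finsupp.single s 1)) = 0 := by
  have hsingle : ∀ (t : Finset P) (c : ℚ), boundary P (Finsupp.single t c) =
      ∑ y ∈ t, Finsupp.single (t.erase y) (c * (-1 : ℚ) ^ (t.filter (· < y)).card) := by
    intro t c
    rw [← mul_one c, ← smul_eq_mul, ← Finsupp.smul_single, map_smul, boundary_single,
      Finset.smul_sum]
    simp
  have key : ∀ x ∈ s, ∀ y ∈ s, x < y →
      (-1 : ℚ) ^ (s.filter (· < x)).card * (-1) ^ ((s.erase x).filter (· < y)).card =
        -((-1) ^ (s.filter (· < y)).card * (-1) ^ ((s.erase y).filter (· < x)).card) := by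
    intro x hx y hy hxy
    have e1 : (s.erase x).filter (· < y) = (s.filter (· < y)).erase x := by
      ext z
      simp only [Finset.mem_filter, Finset.mem_erase]
      tauto
    have e2 : (s.erase y).filter (· < x) = s.filter (· < x) := by
      ext z
      simp only [Finset.mem_filter, Finset.mem_erase]
      exact ⟨fun h => ⟨h.1.2, h.2⟩, fun h => ⟨⟨fun he => (hxy.trans (he ▸ h.2)).false, h.1⟩, h.2⟩⟩
    rw [e1, e2, ← Finset.card_erase_add_one (s := s.filter (· < y)) (a := x)
      (Finset.mem_filter.2 ⟨hx, hxy⟩)]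
    ring
  rw [boundary_single, map_sum]
  simp only [hsingle]
  refine sum_sum_erase_eq_zero s _ fun x hx y hy hxy => ?_
  rw [Finset.erase_right_comm, ← Finsupp.single_neg]
  congr 1
  rcases hs.total hx hy with h | h
  · exact key x hx y hy (lt_of_le_of_ne h hxy)
  · rw [key y hy x hx (lt_of_le_of_ne h hxy.symm), neg_neg]

variable {K : Set (Finset P)}

lemma map_boundary_simplicialChains_le (hK : ∀ s ∈ K, ∀ t ⊆ s, t ∈ K) (k : ℕ) :
    (simplicialChains K (k + 1)).map (boundary P) ≤ simplicialChains K k := by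
  classical
  rw [simplicialChains, Finsupp.supported_eq_span_single, Submodule.map_span, Submodule.span_le]
  rintro _ ⟨_, ⟨s, hs, rfl⟩, rfl⟩
  simp only [boundary_single, SetLike.mem_coe]
  refine Submodule.sum_mem _ fun x hx => ?_
  refine Finsupp.single_mem_supported ℚ _ ⟨?_, ?_⟩
  · convert hK s hs.1 (s.erase x) (Finset.erase_subset _ _)
  · have := Finset.card_erase_add_one hx
    have := hs.2
    convert (by omega : (s.erase x).card = k)

lemma boundary_boundary_eq_zero (hK : K ⊆ orderComplex P) (k : ℕ) :
    ∀ v ∈ simplicialChains K k, boundary P (boundary P v) = 0 := by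
  have : simplicialChains K k ≤ LinearMap.ker (boundary P ∘ₗ boundary P) := by
    rw [simplicialChains, Finsupp.supported_eq_span_single, Submodule.span_le]
    rintro _ ⟨s, hs, rfl⟩
    exact boundary_boundary_single (hK hs.1)
  exact fun v hv => this hv

lemma boundary_eq_zero_of_mem_zero :
    ∀ v ∈ simplicialChains K 0, boundary P v = 0 := by
  have : simplicialChains K 0 ≤ LinearMap.ker (boundary P) := by
    rw [simplicialChains, Finsupp.supported_eq_span_single, Submodule.span_le]
    rintro _ ⟨s, hs, rfl⟩
    obtain rfl := Finset.card_eq_zero.1 hs.2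
    simp [boundary_single]
  exact fun v hv => this hv

omit [PartialOrder P] in
open Classical in
lemma finrank_simplicialChains [Fintype P] (k : ℕ) :
    Module.finrank ℚ (simplicialChains K k) =
      (Finset.univ.filter fun s => s ∈ K ∧ s.card = k).card := by
  rw [simplicialChains, (Finsupp.supportedEquivFinsupp _).finrank_eq, Module.finrank_finsupp_self,
    Fintype.card_subtype]
  rfl

open Classical in
/-- If the reduced homology of a complex vanishes below dimension `m - 1`, its truncated Euler
characteristic has the sign of `(-1) ^ m`. -/
lemma sign_mul_euler_nonneg [Fintype P] (hK : ∀ s ∈ K, ∀ t ⊆ s, t ∈ K)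
    (hK' : K ⊆ orderComplex P) (m : ℕ) (hvan : ∀ k < m, ReducedHomologyVanishes K k)
    (hcard : ∀ s ∈ K, s.card ≤ m) :
    0 ≤ (-1 : ℝ) ^ m * ∑ s ∈ Finset.univ.filter (· ∈ K), (-1 : ℝ) ^ s.card := by
  have h := sum_finrank_of_exact (boundary P) (simplicialChains K)
    (map_boundary_simplicialChains_le hK) (boundary_boundary_eq_zero hK')
    boundary_eq_zero_of_mem_zero m hvan
  have hsum : ∑ s ∈ Finset.univ.filter (· ∈ K), (-1 : ℝ) ^ s.card =
      ∑ k ∈ Finset.range (m + 1), (-1 : ℝ) ^ k * Module.finrank ℚ (simplicialChains K k) := by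
    rw [← Finset.sum_fiberwise_of_maps_to (t := Finset.range (m + 1)) (g := Finset.card)
      (fun s hs => by
        simpa [Nat.lt_succ_iff] using hcard s (Finset.mem_filter.1 hs).2)]
    refine Finset.sum_congr rfl fun k _ => ?_
    rw [finrank_simplicialChains, Finset.filter_filter, Finset.sum_congr rfl
      (g := fun _ => (-1 : ℝ) ^ k) fun s hs => by rw [(Finset.mem_filter.1 hs).2.2],
      Finset.sum_const, nsmul_eq_mul, mul_comm]
  -- The signs cancel, leaving the dimension of the space of top-degree cycles.
  rw [hsum, h, ← mul_assoc, ← mul_pow]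
  simp

end Boundary

/-! ### Positivity of h on [0, ∞) for Cohen–Macaulay posets. -/

section Positivity

lemma mem_orderComplex_of_subset {P : Type*} [PartialOrder P] {s t : Finset P}
    (hs : s ∈ orderComplex P) (h : t ⊆ s) : t ∈ orderComplex P :=
  IsChain.mono (Finset.coe_subset.2 h) hs

open Classical in
lemma mem_link {P : Type*} {K : Set (Finset P)} {F G : Finset P} :
    G ∈ link K F ↔ Disjoint F G ∧ F ∪ G ∈ K :=
  Iff.rfl

open Classical in
lemma eval_hPoly {P : Type*} [PartialOrder P] [Fintype P] (x : ℝ) :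
    (hPoly P).eval x = ∑ s ∈ Finset.univ.filter (· ∈ orderComplex P),
      x ^ s.card * (1 - x) ^ (maxChainCard P - s.card) := by
  rw [hPoly, eval_finsetSum, ← Finset.sum_fiberwise_of_maps_to
    (t := Finset.range (maxChainCard P + 1)) (g := Finset.card)
    (fun s hs => by
      simpa [Nat.lt_succ_iff] using card_le_maxChainCard (Finset.mem_filter.1 hs).2)]
  refine Finset.sum_congr rfl fun k _ => ?_
  rw [Finset.filter_filter, Finset.sum_congr rfl
    (g := fun _ => x ^ k * (1 - x) ^ (maxChainCard P - k))
    fun s hs => by rw [(Finset.mem_filter.1 hs).2.2], Finset.sum_const, nsmul_eq_mul,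
    chainCount_eq_card, show (Finset.univ.filter fun s => s ∈ orderComplex P ∧ s.card = k) =
      chainsOfCard P k by
        ext
        rw [mem_chainsOfCard, Finset.mem_filter, and_iff_right (Finset.mem_univ _)]
        rfl]
  simp [mul_assoc]

open Classical in
/-- The expansion of the `h`-polynomial in powers of `1 - x`; the coefficients are Euler
characteristics of links. -/
lemma eval_hPoly_eq_sum_links {P : Type*} [PartialOrder P] [Fintype P] (x : ℝ) :
    (hPoly P).eval x = ∑ F ∈ Finset.univ.filter (· ∈ orderComplex P),
      (1 - x) ^ (maxChainCard P - F.card) *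
        ∑ G ∈ Finset.univ.filter (· ∈ link (orderComplex P) F), (-1 : ℝ) ^ G.card := by
  have hlink : ∀ F : Finset P,
      ∑ G ∈ Finset.univ.filter (· ∈ link (orderComplex P) F), (-1 : ℝ) ^ G.card =
      ∑ H ∈ Finset.univ.filter (fun H => H ∈ orderComplex P ∧ F ⊆ H),
        (-1 : ℝ) ^ (H.card - F.card) := by
    intro F
    refine Finset.sum_bij' (fun G _ => F ∪ G) (fun H _ => H \ F) ?_ ?_ ?_ ?_ ?_
    · intro G hG
      simp only [Finset.mem_filter, Finset.mem_univ, true_and, mem_link] at hG ⊢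
      exact ⟨hG.2, Finset.subset_union_left⟩
    · intro H hH
      simp only [Finset.mem_filter, Finset.mem_univ, true_and, mem_link] at hH ⊢
      refine ⟨Finset.disjoint_sdiff, ?_⟩
      rw [Finset.union_sdiff_of_subset hH.2]
      exact hH.1
    · intro G hG
      simp only [Finset.mem_filter, Finset.mem_univ, true_and, mem_link] at hG
      exact Finset.union_sdiff_cancel_left hG.1
    · intro H hH
      simp only [Finset.mem_filter, Finset.mem_univ, true_and] at hH
      exact Finset.union_sdiff_of_subset hH.2
    · intro G hG
      simp only [Finset.mem_filter, Finset.mem_univ, true_and, mem_link] at hG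
      rw [Finset.card_union_of_disjoint hG.1, Nat.add_sub_cancel_left]
  simp only [hlink, Finset.mul_sum]
  rw [eval_hPoly, Finset.sum_comm' (t' := Finset.univ.filter (· ∈ orderComplex P))
    (s' := fun H => H.powerset)]
  · refine Finset.sum_congr rfl fun H hH => ?_
    have hle := card_le_maxChainCard (Finset.mem_filter.1 hH).2
    have hpow := Finset.sum_pow_mul_eq_add_pow (1 : ℝ) (-(1 - x)) H
    -- The binomial expansion of x = 1 - (1 - x), indexed by the subsets `F` of `H`; exchanging the
    -- sums then collects the faces `H` containing a given `F`.
    have hx : x ^ H.card = ∑ F ∈ H.powerset,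
        (1 - x) ^ (H.card - F.card) * (-1 : ℝ) ^ (H.card - F.card) := by
      rw [show x = 1 + -(1 - x) by ring, ← hpow]
      refine Finset.sum_congr rfl fun F _ => ?_
      rw [← mul_pow]
      ring
    rw [hx, Finset.sum_mul]
    refine Finset.sum_congr rfl fun F hF => ?_
    have := Finset.card_le_card (Finset.mem_powerset.1 hF)
    rw [show maxChainCard P - F.card = (H.card - F.card) + (maxChainCard P - H.card) by omega,
      pow_add]
    ring
  · intro F H
    simp only [Finset.mem_filter, Finset.mem_univ, true_and, Finset.mem_powerset]
    exact ⟨fun h => ⟨h.2.2, h.2.1⟩, fun h => ⟨mem_orderComplex_of_subset h.2 h.1, h.2, h.1⟩⟩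

variable {L : Type*} [PartialOrder L] [BoundedOrder L] [Finite L]

-- By gradedness the largest faces of the link of `F` have n + 1 - |F| elements, so the
-- Cohen–Macaulay condition leaves homology only in the top dimension, which fixes the sign.
open Classical in
lemma sign_mul_euler_link_nonneg [Fintype L] {n : ℕ} (hL : IsGradedOfRank L n)
    (hCM : IsCohenMacaulay L) {F : Finset L} (hF : F ∈ orderComplex L) :
    0 ≤ (-1 : ℝ) ^ (n + 1 - F.card) *
      ∑ G ∈ Finset.univ.filter (· ∈ link (orderComplex L) F), (-1 : ℝ) ^ G.card := by
  obtain ⟨H, hH, hFH, hcard⟩ := exists_superset_card_eq hL hF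
  have hd : (H \ F) ∈ link (orderComplex L) F := by
    refine ⟨Finset.disjoint_sdiff, ?_⟩
    rw [Finset.union_sdiff_of_subset hFH]
    exact hH
  refine sign_mul_euler_nonneg ?_ ?_ _ ?_ ?_
  · intro s hs t hts
    exact ⟨hs.1.mono_right hts,
      mem_orderComplex_of_subset hs.2 (Finset.union_subset_union_right hts)⟩
  · intro s hs
    exact mem_orderComplex_of_subset hs.2 Finset.subset_union_right
  · intro k hk
    refine hCM F hF k ⟨H \ F, hd, ?_⟩
    rw [Finset.card_sdiff_of_subset hFH]
    omega
  · intro s hs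
    have := card_le_of_isGradedOfRank hL hs.2
    rw [Finset.card_union_of_disjoint hs.1] at this
    omega

/-- The `h`-polynomial of a Cohen–Macaulay graded poset has no nonnegative roots. -/
lemma eval_hPoly_pos {n : ℕ} (hL : IsGradedOfRank L n) (hCM : IsCohenMacaulay L) {x : ℝ}
    (hx : 0 ≤ x) : 0 < (hPoly L).eval x := by
  classical
  cases nonempty_fintype L
  have hN := maxChainCard_of_isGradedOfRank hL
  rcases lt_or_ge x 1 with h1 | h1
  · rw [eval_hPoly]
    refine Finset.sum_pos' (fun s _ => ?_) ⟨∅, by simp [empty_mem_orderComplex], ?_⟩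
    · have : 0 ≤ 1 - x := by linarith
      positivity
    · have : 0 < 1 - x := by linarith
      simp only [Finset.card_empty, pow_zero, one_mul]
      positivity
  -- For x ≥ 1 the sign of (1 - x)^(n+1-|F|) matches that of the Euler characteristic. A maximal
  -- chain has link {∅} and exponent 0, so it contributes 1, even at x = 1.
  · rw [eval_hPoly_eq_sum_links, hN]
    obtain ⟨H, hH, -, hcard⟩ := exists_superset_card_eq hL (empty_mem_orderComplex (P := L))
    refine Finset.sum_pos' (fun F hF => ?_) ⟨H, by simpa using hH, ?_⟩
    · have h := sign_mul_euler_link_nonneg hL hCM (Finset.mem_filter.1 hF).2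
      rw [show (1 - x) = (x - 1) * (-1) by ring, mul_pow, mul_assoc]
      exact mul_nonneg (pow_nonneg (by linarith) _) h
    · have hlink : Finset.univ.filter (· ∈ link (orderComplex L) H) = {∅} := by
        ext G
        simp only [Finset.mem_filter, Finset.mem_univ, true_and, Finset.mem_singleton]
        constructor
        · intro hG
          have := card_le_of_isGradedOfRank hL hG.2
          rw [Finset.card_union_of_disjoint hG.1] at this
          exact Finset.card_eq_zero.1 (by omega)
        · rintro rfl
          exact ⟨Finset.disjoint_empty_right _, by simpa using hH⟩
      rw [hlink, hcard]
      simp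

end Positivity

end ChainPoly

namespace ChainPoly

/-! ### Interlacing and real-rootedness in terms of root counts. -/

section Interlacing

/-- In a weakly decreasing list the entries that are at least `t` form an initial segment. -/
lemma le_getElem_iff_lt_countP (t : ℝ) {l : List ℝ} (hl : l.Pairwise (· ≥ ·)) {i : ℕ}
    (hi : i < l.length) : t ≤ l[i] ↔ i < l.countP (t ≤ ·) := by
  induction l generalizing i with
  | nil => simp at hi
  | cons a l ih =>
    rw [List.pairwise_cons] at hl
    by_cases ha : t ≤ a
    · rw [List.countP_cons_of_pos (by simpa using ha)]
      rcases i with _ | i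
      · simpa using ha
      · rw [List.getElem_cons_succ, ih hl.2]
        omega
    · have h0 : (a :: l).countP (t ≤ ·) = 0 := by
        rw [List.countP_eq_zero]
        intro x hx
        rw [decide_eq_true_eq]
        rcases List.mem_cons.1 hx with rfl | hx
        · exact ha
        · exact fun h => ha (h.trans (hl.1 x hx))
      rw [h0]
      refine iff_of_false (fun h => ?_) (by omega)
      rcases List.mem_cons.1 (List.getElem_mem hi) with h' | h'
      · exact ha (h' ▸ h)
      · exact ha (h.trans (hl.1 _ h'))

lemma le_sortedRoots_getElem_iff (t : ℝ) (f : ℝ[X]) {i : ℕ} (hi : i < (sortedRoots f).length) :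
    t ≤ (sortedRoots f)[i] ↔ i < (f.roots.filter (t ≤ ·)).card := by
  have hsort : (sortedRoots f).Pairwise (· ≥ ·) := Multiset.pairwise_sort _ _
  have hcoe : (sortedRoots f : Multiset ℝ) = f.roots := Multiset.sort_eq _ _
  rw [le_getElem_iff_lt_countP t hsort hi, ← Multiset.countP_eq_card_filter, ← hcoe,
    Multiset.coe_countP]

/-- Interlacing expressed by the number of roots in each interval `[t, ∞)`. -/
lemma interlaces_of_card_roots {f g : ℝ[X]} (hf : IsRealRooted f) (hg : IsRealRooted g)
    (hcard : g.roots.card = f.roots.card ∨ g.roots.card = f.roots.card + 1)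
    (h1 : ∀ t, (f.roots.filter (t ≤ ·)).card ≤ (g.roots.filter (t ≤ ·)).card)
    (h2 : ∀ t, (g.roots.filter (t ≤ ·)).card ≤ (f.roots.filter (t ≤ ·)).card + 1) :
    Interlaces f g := by
  refine ⟨hf, hg, Or.inr (Or.inr ⟨?_, fun i hi hi' => ?_, fun i hi hi' => ?_⟩)⟩
  · simpa [sortedRoots] using hcard
  · rw [le_sortedRoots_getElem_iff]
    exact ((le_sortedRoots_getElem_iff _ f hi).1 le_rfl).trans_le (h1 _)
  · rw [le_sortedRoots_getElem_iff]
    have h3 := (le_sortedRoots_getElem_iff _ g hi').1 le_rfl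
    have h4 := h2 (sortedRoots g)[i + 1]
    omega

/-- After division by all real linear factors, a nonconstant cofactor would have a complex zero;
this is a zero of `f`, hence real, but the cofactor has no real root. -/
lemma card_roots_of_isRealRooted {f : ℝ[X]} (hf : IsRealRooted f) :
    f.roots.card = f.natDegree := by
  rcases hf with rfl | hf
  · simp
  obtain ⟨q, hq, hdeg, hroots⟩ := exists_prod_multiset_X_sub_C_mul f
  by_contra hne
  obtain ⟨z, hz⟩ := IsAlgClosed.exists_aeval_eq_zero ℂ q
    (fun h => hne (by rw [natDegree_eq_zero_iff_degree_le_zero.2 h.le] at hdeg; omega))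
  have hzf : aeval z f = 0 := by rw [← hq, map_mul, hz, mul_zero]
  have hzr : z = algebraMap ℝ ℂ z.re := by
    apply Complex.ext
    · simp
    · simpa using hf z hzf
  have hq0 : q ≠ 0 := by
    rintro rfl
    rw [natDegree_zero] at hdeg
    omega
  rw [hzr, aeval_algebraMap_apply, map_eq_zero] at hz
  have : z.re ∈ q.roots := (mem_roots hq0).2 hz
  rw [hroots] at this
  simp at this

lemma isRealRooted_of_card_roots {f : ℝ[X]} (hf : f.natDegree ≤ f.roots.card) :
    IsRealRooted f := by
  by_cases hf0 : f = 0
  · exact Or.inl hf0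
  right
  intro z hz
  obtain ⟨q, hq, hdeg, -⟩ := exists_prod_multiset_X_sub_C_mul f
  obtain ⟨c, rfl⟩ := natDegree_eq_zero.1 (show q.natDegree = 0 by omega)
  have hc : c ≠ 0 := by
    rintro rfl
    rw [C_0, mul_zero] at hq
    exact hf0 hq.symm
  rw [← hq, map_mul, aeval_C, mul_eq_zero, map_eq_zero (algebraMap ℝ ℂ), or_iff_left hc, map_multiset_prod,
    Multiset.prod_eq_zero_iff, Multiset.map_map, Multiset.mem_map] at hz
  obtain ⟨α, -, hα⟩ := hz
  simp only [Function.comp_apply, map_sub, aeval_X, aeval_C, sub_eq_zero] at hα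
  rw [hα]
  simp

/-- Passing from `A` to `B` loses at most one copy of each distinct element of `A`; elements of `B`
outside `A` make up for this, with `c` to spare. -/
lemma card_add_le_card_of_count {A B : Multiset ℝ} {c : ℕ}
    (hcount : ∀ x ∈ A, A.count x ≤ B.count x + 1)
    (h : A.toFinset.card + c ≤ (B.toFinset \ A.toFinset).card) : A.card + c ≤ B.card := by
  have h1 : A.card ≤ ∑ x ∈ A.toFinset, B.count x + A.toFinset.card := by
    rw [← Multiset.toFinset_sum_count_eq A, Finset.card_eq_sum_ones, ← Finset.sum_add_distrib]
    exact Finset.sum_le_sum fun x hx => hcount x (Multiset.mem_toFinset.1 hx)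
  have h2 : (B.toFinset \ A.toFinset).card ≤ ∑ x ∈ B.toFinset \ A.toFinset, B.count x := by
    rw [Finset.card_eq_sum_ones]
    refine Finset.sum_le_sum fun x hx => ?_
    exact Multiset.one_le_count_iff_mem.2 (Multiset.mem_toFinset.1 (Finset.mem_sdiff.1 hx).1)
  have h3 : ∑ x ∈ A.toFinset, B.count x + ∑ x ∈ B.toFinset \ A.toFinset, B.count x ≤ B.card := by
    rw [← Finset.sum_union Finset.disjoint_sdiff, Finset.union_sdiff_self_eq_union,
      ← Multiset.sum_count_eq_card (s := A.toFinset ∪ B.toFinset) (m := B)]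
    intro x hx
    exact Finset.mem_union_right _ (Multiset.mem_toFinset.2 hx)
  omega

end Interlacing

/-! ### Rolle's theorem for x h^b / (1 - x)^e. -/

section Rolle

/-- The polynomial `(1 + (e - 1) x) h + b (x - x²) h'`. -/
noncomputable def rollePoly (h : ℝ[X]) (b e : ℕ) : ℝ[X] :=
  (1 + ((e : ℝ[X]) - 1) * X) * h + (b : ℝ[X]) * (X - X ^ 2) * derivative h

variable {h : ℝ[X]} {b e : ℕ}

lemma natDegree_rollePoly_le : (rollePoly h b e).natDegree ≤ h.natDegree + 1 := by
  refine natDegree_add_le_of_degree_le ?_ ?_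
  · rw [add_comm h.natDegree]
    refine natDegree_mul_le_of_le ?_ le_rfl
    compute_degree
  · by_cases hd : h.natDegree = 0
    · rw [derivative_of_natDegree_zero hd]
      simp
    · have h1 : ((b : ℝ[X]) * (X - X ^ 2)).natDegree ≤ 2 := by compute_degree
      have := natDegree_mul_le_of_le h1 (natDegree_derivative_le h)
      omega

/-- At a root of multiplicity m, both h and h' are divisible by the power m - 1 of the linear
factor. -/
lemma count_roots_le_rollePoly (hg : rollePoly h b e ≠ 0) (x : ℝ) :
    h.roots.count x ≤ (rollePoly h b e).roots.count x + 1 := by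
  rw [count_roots, count_roots]
  rw [← Nat.sub_le_iff_le_add, le_rootMultiplicity_iff hg]
  have hd := pow_rootMultiplicity_dvd h x
  have h1 : (X - C x) ^ (rootMultiplicity x h - 1) ∣ h :=
    (pow_dvd_pow _ (Nat.sub_le _ _)).trans hd
  have h2 : (X - C x) ^ (rootMultiplicity x h - 1) ∣ derivative h :=
    pow_sub_one_dvd_derivative_of_pow_dvd hd
  exact dvd_add (h1.mul_left _) (h2.mul_left _)

/-- The function to which Rolle's theorem is applied. -/
noncomputable def rolleFun (h : ℝ[X]) (b e : ℕ) (x : ℝ) : ℝ :=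
  x * h.eval x ^ b / (1 - x) ^ e

lemma hasDerivAt_rolleFun (hb : 0 < b) (he : 0 < e) {x : ℝ} (hx : x ≤ 0) :
    HasDerivAt (rolleFun h b e)
      (h.eval x ^ (b - 1) * (rollePoly h b e).eval x / (1 - x) ^ (e + 1)) x := by
  have hx1 : (1 - x) ≠ 0 := by linarith
  obtain ⟨b, rfl⟩ : ∃ c, b = c + 1 := ⟨b - 1, by omega⟩
  obtain ⟨e, rfl⟩ : ∃ c, e = c + 1 := ⟨e - 1, by omega⟩
  have h1 := ((hasDerivAt_id x).mul ((h.hasDerivAt x).pow (b + 1))).div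
    (((hasDerivAt_const x (1 : ℝ)).sub (hasDerivAt_id x)).pow (e + 1)) (pow_ne_zero _ hx1)
  refine HasDerivAt.congr_deriv h1 ?_
  simp only [rollePoly, eval_add, eval_mul, eval_sub, eval_pow, eval_X, eval_one, eval_natCast,
    id, Nat.add_sub_cancel, Pi.sub_apply, Pi.pow_apply, Pi.mul_apply]
  push_cast
  field_simp
  ring

/-- Rolle's theorem; as h has no zero in between, the factor h^(b-1) of the derivative cannot be the
one that vanishes. -/
lemma exists_rollePoly_root (hb : 0 < b) (he : 0 < e) {x y : ℝ} (hxy : x < y) (hy : y ≤ 0)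
    (heq : rolleFun h b e x = rolleFun h b e y) (hne : ∀ z, x < z → z < y → h.eval z ≠ 0) :
    ∃ z, x < z ∧ z < y ∧ (rollePoly h b e).eval z = 0 := by
  obtain ⟨z, hz, hz0⟩ := exists_hasDerivAt_eq_zero hxy
    (fun z hz => (hasDerivAt_rolleFun hb he (hz.2.trans hy)).continuousAt.continuousWithinAt)
    heq (fun z hz => hasDerivAt_rolleFun (h := h) (b := b) (e := e) hb he (hz.2.le.trans hy))
  refine ⟨z, hz.1, hz.2, ?_⟩
  have h1 : (1 - z) ^ (e + 1) ≠ 0 := pow_ne_zero _ (by linarith [hz.2])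
  rw [div_eq_zero_iff, or_iff_left h1, mul_eq_zero] at hz0
  exact hz0.resolve_left (pow_ne_zero _ (hne z hz.1 hz.2))

lemma tendsto_rolleFun_atBot (hdeg : b * h.natDegree + 1 < e) :
    Filter.Tendsto (rolleFun h b e) Filter.atBot (nhds 0) := by
  have hlim := div_tendsto_atBot_zero_of_degree_lt (X * h ^ b) ((1 - X : ℝ[X]) ^ e) (by
    apply degree_lt_degree
    rw [natDegree_pow, show (1 - X : ℝ[X]) = -(X - C 1) by simp, natDegree_neg,
      natDegree_X_sub_C]
    have h1 : (X * h ^ b).natDegree ≤ 1 + b * h.natDegree :=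
      natDegree_mul_le_of_le natDegree_X_le natDegree_pow_le
    omega)
  refine hlim.congr fun x => ?_
  simp [rolleFun]

/-- To the left of all zeros of `rolleFun` there is another critical point. -/
lemma exists_rollePoly_root_left (hb : 0 < b) (hdeg : b * h.natDegree + 1 < e) {c : ℝ}
    (hc : c ≤ 0) (hc0 : rolleFun h b e c = 0) (hne : ∀ z < c, h.eval z ≠ 0) :
    ∃ z < c, (rollePoly h b e).eval z = 0 := by
  have he : 0 < e := by omega
  have hf0 : ∀ z < c, rolleFun h b e z ≠ 0 := by
    intro z hz
    exact div_ne_zero (mul_ne_zero (by linarith) (pow_ne_zero _ (hne z hz)))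
      (pow_ne_zero _ (by linarith))
  have hcont : ContinuousOn (fun x => |rolleFun h b e x|) (Set.Iic 0) := fun z hz =>
    (hasDerivAt_rolleFun hb he hz).continuousAt.continuousWithinAt.abs
  have hlim := (tendsto_rolleFun_atBot hdeg).abs
  rw [abs_zero] at hlim
  -- Decay at -∞ gives `w` with |φ(w)| < |φ(c - 1)|. Since φ(c) = 0, the value |φ(w)| is taken again
  -- at some `v` between `c - 1` and `c`.
  obtain ⟨w, hw, hwc⟩ := ((hlim.eventually_lt_const (abs_pos.2 (hf0 (c - 1) (by linarith)))).and
    (Filter.eventually_lt_atBot (c - 1))).exists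
  obtain ⟨v, hv, hvw⟩ := intermediate_value_Ioo' (show c - 1 ≤ c by linarith)
    (hcont.mono fun z hz => hz.2.trans hc)
    (show |rolleFun h b e w| ∈ Set.Ioo |rolleFun h b e c| |rolleFun h b e (c - 1)| from
      ⟨by rw [hc0, abs_zero]; exact abs_pos.2 (hf0 w (by linarith)), hw⟩)
  have hwv : w < v := hwc.trans hv.1
  have heq : rolleFun h b e w = rolleFun h b e v := by
    -- Opposite values would force a zero of φ between `w` and `v`, to the left of `c`.
    rcases abs_eq_abs.1 hvw with h1 | h1
    · exact h1.symm
    · exfalso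
      have hcont' : ContinuousOn (rolleFun h b e) (Set.uIcc w v) := by
        intro z hz
        rw [Set.uIcc_of_le hwv.le] at hz
        exact (hasDerivAt_rolleFun hb he
          (hz.2.trans (hv.2.le.trans hc))).continuousAt.continuousWithinAt
      have h0 : (0 : ℝ) ∈ Set.uIcc (rolleFun h b e w) (rolleFun h b e v) := by
        rw [h1, Set.mem_uIcc]
        rcases le_total 0 (rolleFun h b e w) with h | h
        · exact Or.inr ⟨by linarith, h⟩
        · exact Or.inl ⟨h, by linarith⟩
      obtain ⟨z, hz, hz0⟩ := intermediate_value_uIcc hcont' h0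
      rw [Set.uIcc_of_le hwv.le] at hz
      exact hf0 z (hz.2.trans_lt hv.2) hz0
  obtain ⟨z, -, hz2, hz3⟩ := exists_rollePoly_root hb he hwv (hv.2.le.trans hc) heq
    fun z _ hz => hne z (hz.trans hv.2)
  exact ⟨z, hz2.trans hv.2, hz3⟩

lemma rolleFun_eq_zero (hb : 0 < b) {x : ℝ} (hx : x = 0 ∨ h.eval x = 0) :
    rolleFun h b e x = 0 := by
  rcases hx with rfl | hx
  · simp [rolleFun]
  · simp [rolleFun, hx, hb.ne']

lemma rollePoly_ne_zero (hpos : ∀ x, 0 ≤ x → 0 < h.eval x) : rollePoly h b e ≠ 0 := by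
  intro h0
  have h1 : (rollePoly h b e).eval 0 = h.eval 0 := by simp [rollePoly]
  have := hpos 0 le_rfl
  rw [h0, eval_zero] at h1
  linarith

lemma ne_zero_of_eval_pos (hpos : ∀ x, 0 ≤ x → 0 < h.eval x) : h ≠ 0 := by
  rintro rfl
  simpa using hpos 0 le_rfl

/-- Critical points separate consecutive zeros within a convex set `I`. -/
lemma interleaved_rollePoly_roots (hpos : ∀ x, 0 ≤ x → 0 < h.eval x) (hb : 0 < b) (he : 0 < e)
    {I : ℝ → Prop} {s : Finset ℝ} (hs : ∀ x ∈ s, x = 0 ∨ h.eval x = 0)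
    (hs' : ∀ x, I x → h.eval x = 0 → x ∈ s)
    (hI : ∀ x ∈ s, ∀ y ∈ s, ∀ z, x < z → z < y → I z) :
    ∀ x ∈ s, ∀ y ∈ s, x < y → (∀ z ∈ s, z ∉ Set.Ioo x y) →
      ∃ z, (I z ∧ (rollePoly h b e).eval z = 0) ∧ x < z ∧ z < y := by
  intro x hx y hy hxy hcons
  have hy0 : y ≤ 0 := by
    rcases hs y hy with h | h
    · exact h.le
    · by_contra hlt
      exact (hpos y (not_le.1 hlt).le).ne' h
  obtain ⟨z, hz1, hz2, hz3⟩ := exists_rollePoly_root (h := h) hb he hxy hy0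
    (by rw [rolleFun_eq_zero hb (hs x hx), rolleFun_eq_zero hb (hs y hy)])
    fun z hz1 hz2 hz0 => hcons z (hs' z (hI x hx y hy z hz1 hz2) hz0) ⟨hz1, hz2⟩
  exact ⟨z, ⟨hI x hx y hy z hz1 hz2, hz3⟩, hz1, hz2⟩

lemma exists_rollePoly_root_left_of_roots (hpos : ∀ x, 0 ≤ x → 0 < h.eval x) (hb : 0 < b)
    (hdeg : b * h.natDegree + 1 < e) :
    ∃ z < 0, (∀ x, h.eval x = 0 → z < x) ∧ (rollePoly h b e).eval z = 0 := by
  have hh := ne_zero_of_eval_pos hpos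
  obtain ⟨c, hc, hmin⟩ := (insert 0 h.roots.toFinset).exists_min_image id ⟨0, by simp⟩
  simp only [Finset.mem_insert, Multiset.mem_toFinset, mem_roots hh, IsRoot.def, id] at hc hmin
  have hc0 : c ≤ 0 := hmin 0 (Or.inl rfl)
  obtain ⟨z, hz, hz0⟩ := exists_rollePoly_root_left hb hdeg hc0 (rolleFun_eq_zero hb hc)
    fun z hz h0 => (hmin z (Or.inr h0)).not_gt hz
  exact ⟨z, hz.trans_le hc0, fun x hx => hz.trans_le (hmin x (Or.inr hx)), hz0⟩

/-- For t ≤ 0, the p distinct roots of h in [t, 0) together with 0 bound p gaps, each containing a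
new root; these make up for the lost multiplicities. -/
lemma card_roots_filter_ge_le (hpos : ∀ x, 0 ≤ x → 0 < h.eval x) (hb : 0 < b) (he : 0 < e)
    (t : ℝ) :
    (h.roots.filter (t ≤ ·)).card ≤ ((rollePoly h b e).roots.filter (t ≤ ·)).card := by
  have hh := ne_zero_of_eval_pos hpos
  have hg := rollePoly_ne_zero (b := b) (e := e) hpos
  rcases lt_or_ge 0 t with ht | ht
  · rw [Multiset.filter_eq_nil.2]
    · simp
    · intro x hx htx
      exact (hpos x (ht.le.trans htx)).ne' ((mem_roots hh).1 hx)
  refine card_add_le_card_of_count (c := 0) (fun x hx => ?_) ?_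
  · have hx := (Multiset.mem_filter.1 hx).2
    rw [Multiset.count_filter_of_pos hx, Multiset.count_filter_of_pos hx]
    exact count_roots_le_rollePoly hg x
  set A := (h.roots.filter (t ≤ ·)).toFinset with hA
  set B := ((rollePoly h b e).roots.filter (t ≤ ·)).toFinset with hB
  have hmemA : ∀ x, x ∈ A ↔ h.eval x = 0 ∧ t ≤ x := by
    intro x
    simp [hA, hh]
  have h0A : (0 : ℝ) ∉ A := fun h => (hpos 0 le_rfl).ne' ((hmemA 0).1 h).1
  have hcard := Finset.card_le_sdiff_of_interleaved (s := insert 0 A) (t := B)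
    fun x hx y hy hxy hcons => by
      obtain ⟨z, ⟨hz1, hz2⟩, hz⟩ := interleaved_rollePoly_roots hpos hb he (I := (t ≤ ·))
        (s := insert 0 A)
        (fun x hx => (Finset.mem_insert.1 hx).imp_right fun h => ((hmemA x).1 h).1)
        (fun x hx h0 => Finset.mem_insert_of_mem ((hmemA x).2 ⟨h0, hx⟩))
        (fun x hx y _ z hxz _ => by
          rcases Finset.mem_insert.1 hx with rfl | hx
          · exact ht.trans hxz.le
          · exact ((hmemA x).1 hx).2.trans hxz.le) x hx y hy hxy hcons
      exact ⟨z, by simp [hB, hg, hz1, hz2], hz⟩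
  rw [Finset.card_insert_of_notMem h0A] at hcard
  have := Finset.card_le_card (Finset.sdiff_subset_sdiff (le_refl B) (Finset.subset_insert 0 A))
  omega

/-- Here p distinct roots bound only p - 1 gaps, and the missing root is the one to the left of them
all. It is erased from `B` so that the gaps are counted separately. -/
lemma card_roots_filter_lt_le (hpos : ∀ x, 0 ≤ x → 0 < h.eval x) (hb : 0 < b)
    (hdeg : b * h.natDegree + 1 < e) (t : ℝ) :
    (h.roots.filter fun x => ¬ t ≤ x).card ≤ ((rollePoly h b e).roots.filter fun x => ¬ t ≤ x).card := by
  have hh := ne_zero_of_eval_pos hpos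
  have hg := rollePoly_ne_zero (b := b) (e := e) hpos
  refine card_add_le_card_of_count (c := 0) (fun x hx => ?_) ?_
  · have hx := (Multiset.mem_filter.1 hx).2
    rw [Multiset.count_filter_of_pos (p := fun x => ¬ t ≤ x) hx,
      Multiset.count_filter_of_pos (p := fun x => ¬ t ≤ x) hx]
    exact count_roots_le_rollePoly hg x
  set A := (h.roots.filter fun x => ¬ t ≤ x).toFinset with hA
  set B := ((rollePoly h b e).roots.filter fun x => ¬ t ≤ x).toFinset with hB
  have hmemA : ∀ x, x ∈ A ↔ h.eval x = 0 ∧ x < t := by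
    intro x
    simp [hA, hh]
  rcases A.eq_empty_or_nonempty with hA0 | ⟨a, ha⟩
  · simp [hA0]
  obtain ⟨w, -, hw, hw0⟩ := exists_rollePoly_root_left_of_roots hpos hb hdeg
  have hwA : w ∉ A := fun h => (hw w ((hmemA w).1 h).1).false
  have hwB : w ∈ B := by
    have := (hw a ((hmemA a).1 ha).1).trans ((hmemA a).1 ha).2
    simp [hB, hg, hw0, this]
  have hcard := Finset.card_le_sdiff_of_interleaved (s := A) (t := B.erase w)
    fun x hx y hy hxy hcons => by
      obtain ⟨z, ⟨hz1, hz2⟩, hz⟩ := interleaved_rollePoly_roots hpos hb (by omega : 0 < e)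
        (I := (· < t)) (s := A)
        (fun x hx => Or.inr ((hmemA x).1 hx).1)
        (fun x hx h0 => (hmemA x).2 ⟨h0, hx⟩)
        (fun x _ y hy z _ hzy => hzy.trans ((hmemA y).1 hy).2) x hx y hy hxy hcons
      exact ⟨z, Finset.mem_erase.2 ⟨((hw x ((hmemA x).1 hx).1).trans hz.1).ne',
        by simp [hB, hg, hz1, hz2]⟩, hz⟩
  rw [Finset.erase_sdiff_comm] at hcard
  have := Finset.card_erase_add_one (Finset.mem_sdiff.2 ⟨hwB, hwA⟩)
  omega

/-- Both the zero at 0 and the leftmost critical point are available, giving p + 1 new roots for p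
distinct roots of h. -/
lemma card_roots_succ_le (hpos : ∀ x, 0 ≤ x → 0 < h.eval x) (hb : 0 < b)
    (hdeg : b * h.natDegree + 1 < e) :
    h.roots.card + 1 ≤ (rollePoly h b e).roots.card := by
  have hh := ne_zero_of_eval_pos hpos
  have hg := rollePoly_ne_zero (b := b) (e := e) hpos
  refine card_add_le_card_of_count (fun x _ => count_roots_le_rollePoly hg x) ?_
  set A := h.roots.toFinset with hA
  set B := (rollePoly h b e).roots.toFinset with hB
  have hmemA : ∀ x, x ∈ A ↔ h.eval x = 0 := by
    intro x
    simp [hA, hh]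
  have h0A : (0 : ℝ) ∉ A := fun h => (hpos 0 le_rfl).ne' ((hmemA 0).1 h)
  obtain ⟨w, hwneg, hw, hw0⟩ := exists_rollePoly_root_left_of_roots hpos hb hdeg
  have hwA : w ∉ A := fun h => (hw w ((hmemA w).1 h)).false
  have hwB : w ∈ B := by simp [hB, hg, hw0]
  have hcard := Finset.card_le_sdiff_of_interleaved (s := insert 0 A) (t := B.erase w)
    fun x hx y hy hxy hcons => by
      have hx' := (Finset.mem_insert.1 hx).imp_right (hmemA x).1
      obtain ⟨z, ⟨-, hz2⟩, hz⟩ := interleaved_rollePoly_roots hpos hb (by omega : 0 < e)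
        (I := fun _ => True) (s := insert 0 A)
        (fun x hx => (Finset.mem_insert.1 hx).imp_right (hmemA x).1)
        (fun x _ h0 => Finset.mem_insert_of_mem ((hmemA x).2 h0))
        (fun _ _ _ _ _ _ _ => trivial) x hx y hy hxy hcons
      have hwx : w < x := by
        rcases hx' with rfl | hx'
        · exact hwneg
        · exact hw x hx'
      exact ⟨z, Finset.mem_erase.2 ⟨(hwx.trans hz.1).ne', by simp [hB, hg, hz2]⟩, hz⟩
  rw [Finset.card_insert_of_notMem h0A, Finset.erase_sdiff_comm] at hcard
  have h1 := Finset.card_le_card (Finset.erase_subset_erase w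
    (Finset.sdiff_subset_sdiff (le_refl B) (Finset.subset_insert 0 A)))
  have := Finset.card_erase_add_one (Finset.mem_sdiff.2 ⟨hwB, hwA⟩)
  omega

lemma isRealRooted_and_interlaces_rollePoly (hpos : ∀ x, 0 ≤ x → 0 < h.eval x)
    (hh : IsRealRooted h) (hb : 0 < b) (hdeg : b * h.natDegree + 1 < e) :
    IsRealRooted (rollePoly h b e) ∧ Interlaces h (rollePoly h b e) := by
  have hcard := card_roots_of_isRealRooted hh
  have h1 := card_roots_succ_le hpos hb hdeg
  have h2 := card_roots' (rollePoly h b e)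
  have h3 := natDegree_rollePoly_le (h := h) (b := b) (e := e)
  have hg : IsRealRooted (rollePoly h b e) := isRealRooted_of_card_roots (by omega)
  refine ⟨hg, interlaces_of_card_roots hh hg (Or.inr (by omega))
    (card_roots_filter_ge_le hpos hb (by omega)) fun t => ?_⟩
  -- The totals are deg h and deg h + 1, so the lower bound on (-∞, t) becomes the required upper
  -- bound on [t, ∞).
  have h4 := card_roots_filter_lt_le hpos hb hdeg t
  have h5 := congrArg Multiset.card (Multiset.filter_add_not (t ≤ ·) h.roots)
  have h6 := congrArg Multiset.card (Multiset.filter_add_not (t ≤ ·) (rollePoly h b e).roots)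
  rw [Multiset.card_add] at h5 h6
  omega

end Rolle

end ChainPoly

theorem theorem5p3 {L : Type*} [PartialOrder L] [BoundedOrder L] [Finite L] (n : ℕ) (hn : 0 < n)
    (hL : ChainPoly.IsGradedOfRank L n) :
    (ChainPoly.hPoly (ChainPoly.Pyr L) =
        (1 + (n : ℝ[X]) * X) * ChainPoly.hPoly L
          + (X - X ^ 2) * derivative (ChainPoly.hPoly L) ∧
      ChainPoly.hPoly (ChainPoly.Prism L) =
        (1 + (2 * (n : ℝ[X]) - 1) * X) * ChainPoly.hPoly L
          + 2 * (X - X ^ 2) * derivative (ChainPoly.hPoly L) ∧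
      ChainPoly.hPoly (ChainPoly.Prism L) =
        2 * ChainPoly.hPoly (ChainPoly.Pyr L) - (1 + X) * ChainPoly.hPoly L) ∧
    (ChainPoly.IsCohenMacaulay L → ChainPoly.IsRealRooted (ChainPoly.hPoly L) →
      ChainPoly.IsRealRooted (ChainPoly.hPoly (ChainPoly.Pyr L)) ∧
      ChainPoly.IsRealRooted (ChainPoly.hPoly (ChainPoly.Prism L)) ∧
      ChainPoly.Interlaces (ChainPoly.hPoly L) (ChainPoly.hPoly (ChainPoly.Pyr L)) ∧
      ChainPoly.Interlaces (ChainPoly.hPoly L) (ChainPoly.hPoly (ChainPoly.Prism L))) := by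
  have hpyr := ChainPoly.hPoly_pyr hL
  have hprism := ChainPoly.hPoly_prism hn hL
  refine ⟨⟨hpyr, hprism, ?_⟩, fun hCM hreal => ?_⟩
  · rw [hpyr, hprism]
    ring
  have hdeg := ChainPoly.natDegree_hPoly_lt hn hL
  have hpos : ∀ x, 0 ≤ x → 0 < (ChainPoly.hPoly L).eval x :=
    fun x hx => ChainPoly.eval_hPoly_pos hL hCM hx
  -- With deg h ≤ n - 1, the decay condition b deg h + 1 < e reduces to n < n + 1 here and to 2n - 1
  -- < 2n for the prism.
  have h1 := ChainPoly.isRealRooted_and_interlaces_rollePoly hpos hreal (b := 1) (e := n + 1)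
    (by omega) (by omega)
  have h2 := ChainPoly.isRealRooted_and_interlaces_rollePoly hpos hreal (b := 2) (e := 2 * n)
    (by omega) (by omega)
  have e1 : ChainPoly.hPoly (ChainPoly.Pyr L) =
      ChainPoly.rollePoly (ChainPoly.hPoly L) 1 (n + 1) := by
    rw [hpyr, ChainPoly.rollePoly]
    push_cast
    ring
  have e2 : ChainPoly.hPoly (ChainPoly.Prism L) =
      ChainPoly.rollePoly (ChainPoly.hPoly L) 2 (2 * n) := by
    rw [hprism, ChainPoly.rollePoly]
    push_cast
    ring
  rw [e1, e2]
  exact ⟨h1.1, h2.1, h1.2, h2.2⟩
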